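/- **Conventions.** Let $N\ge 1$. A compact matrix quantum group (CMQG) $G=(C(G),u)$ is a unital C*-algebra $C(G)$ with a matrix $u\in M_N(C(G))$ such that the entries $u_{ij}$ generate $C(G)$, $u$ and $u^t$ are invertible, and $u_{ij}\mapsto\sum_k u_{ik}\otimes u_{kj}$ extends to a unital $*$-homomorphism $C(G)\to C(G)\otimes_{\min}C(G)$. We write $H\subset G$ if there is a surjective $*$-homomorphism $C(G)\to C(H)$ mapping $u_{ij}$ to the corresponding generator of $C(H)$, and $H=G$ if there is a $*$-isomorphism with this property. For an invertible $T\in M_N(\mathbb C)$ let $TGT^{-1}:=(C(G),TuT^{-1})$. Here $S_N$ is the group of permutation matrices, and $C(O_N^+)$ is the universal C*-algebra generated by $u_{ij}=u_{ij}^*$ with $uu^t=u^tu=1$. Let $\mathscr P_{N\text{-lin}}(k,l)$ be the space of formal complex linear combinations of partitions of $k$ upper and $l$ lower points, with tensor product (side by side), composition $qp$ ($q$ placed below $p$, with a factor $N$ for each removed component) and antilinear involution (vertical reflection). A linear category of partitions $\mathscr K$ is a family of subspaces $\mathscr K(k,l)\subset\mathscr P_{N\text{-lin}}(k,l)$ that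 is closed under these operations and contains the identity partition $\mathrm{id}\in\mathscr P(1,1)$ and the pair partition in $\mathscr P(0,2)$. For a partition $p$ let $T_p:(\mathbb C^N)^{\otimes k}\to(\mathbb C^N)^{\otimes l}$ have the entry $1$ at $(\mathbf j,\mathbf i)$ if the points of each block carry equal indices and $0$ otherwise, extended linearly in $p$. We say that $G$ corresponds to $\mathscr K$ if $\{T\mid Tu^{\otimes k}=u^{\otimes l}T\}=\{T_p\mid p\in\mathscr K(k,l)\}$ for all $k,l\ge 0$. Let $B_N^{\#+}$ be given by the universal C*-algebra generated by $u_{ij}=u_{ij}^*$ with $uu^t=u^tu=1$ and $T_pu^{\otimes k}=u^{\otimes l}T_p$ for all $p\in\mathscr K(k,l)$, $k,l\ge0$, where $\mathscr K$ is the smallest linear category of partitions containing the double singleton ${\uparrow}\otimes{\uparrow}\in\mathscr P(0,2)$. Finally put $\tau_{(N)}:=\mathrm{id}-\frac2N d\in\mathscr P_{N\text{-lin}}(1,1)$, where $d\in\mathscr P(1,1)$ is the partition into two singletons, and $\mathcal T_{(N)}p:=\tau_{(N)}^{\otimes l}\,p\,\tau_{(N)}^{\otimes k}$ for $p\in\mathscr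 P_{N\text{-lin}}(k,l)$. **Theorem B.** (1) Let $G$ be a CMQG with $S_N\subset G\subset O_N^+$ corresponding to a linear category of partitions $\mathscr K$. Then $T_{\tau_{(N)}}$ is invertible, and $\tilde G:=T_{\tau_{(N)}}GT_{\tau_{(N)}}^{-1}$ is a CMQG with $S_N\subset\tilde G\subset O_N^+$. The family $\mathcal T_{(N)}\mathscr K=\{\tau_{(N)}^{\otimes l}p\,\tau_{(N)}^{\otimes k}\mid p\in\mathscr K(k,l)\}_{k,l\ge0}$ is a linear category of partitions, $\tilde G$ corresponds to it, and $\mathcal T_{(N)}$ is a monoidal $*$-isomorphism $\mathscr K\to\mathcal T_{(N)}\mathscr K$, as well as a monoidal $*$-isomorphism of $\mathscr P_{N\text{-lin}}$ onto itself (that is, it is linear and bijective on the morphism spaces and preserves identities, tensor products, compositions and involutions). If ${\uparrow}\otimes{\uparrow}\in\mathscr K(0,2)$, then $\tilde G=G$. (2) If $G$ is a CMQG with $S_N\subset G\subset B_N^{\#+}$, then $T_{\tau_{(N)}}GT_{\tau_{(N)}}^{-1}=G$. (3) Let $N\ge2$ and let $G$ be a CMQG with $S_N\subset G\subset B_N^{\#+}$.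 Let $V_{(N,\pm)}$ be the $(N-1)\times N$ matrix with entries $\delta_{ij}-\frac1{N-1}\bigl(1\pm\frac1{\sqrt N}\bigr)$ for $i,j\le N-1$ and $\pm\frac1{\sqrt N}$ for $j=N$. Let $v_\pm:=V_{(N,\pm)}uV_{(N,\pm)}^*$ and $G^{\rm irr}_\pm:=(A_\pm,v_\pm)$, where $A_\pm\subset C(G)$ is the C*-subalgebra generated by the entries of $v_\pm$. Then $T_{\tau_{(N-1)}}$ is invertible and $T_{\tau_{(N-1)}}G^{\rm irr}_\pm T_{\tau_{(N-1)}}^{-1}=G^{\rm irr}_\mp$. -/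

import Mathlib

universe u v

open scoped TensorProduct

noncomputable section

/-- A C*-seminorm on a unital complex *-algebra. -/
structure CStarSeminorm (F : Type u) [Ring F] [StarRing F] [Algebra ℂ F] where
  toFun : F → ℝ
  add_le' : ∀ a b, toFun (a + b) ≤ toFun a + toFun b
  smul' : ∀ (c : ℂ) a, toFun (c • a) = ‖c‖ * toFun a
  mul_le' : ∀ a b, toFun (a * b) ≤ toFun a * toFun b
  star_mul_self' : ∀ a, toFun (star a * a) = toFun a ^ 2

namespace CStarSeminorm

variable {F : Type u} [Ring F] [StarRing F] [Algebra ℂ F]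

theorem zero' (p : CStarSeminorm F) : p.toFun 0 = 0 := by
  simpa using p.smul' 0 0

theorem neg' (p : CStarSeminorm F) (a : F) : p.toFun (-a) = p.toFun a := by
  simpa using p.smul' (-1) a

theorem nonneg' (p : CStarSeminorm F) (a : F) : 0 ≤ p.toFun a := by
  have h := p.add_le' a (-a)
  rw [add_neg_cancel, p.zero', p.neg'] at h
  linarith

theorem le_star (p : CStarSeminorm F) (a : F) : p.toFun a ≤ p.toFun (star a) := by
  have h := p.mul_le' (star a) a
  rw [p.star_mul_self'] at h
  rcases (p.nonneg' a).eq_or_lt with h0 | h0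
  · rw [← h0]
    exact p.nonneg' _
  · nlinarith

theorem star' (p : CStarSeminorm F) (a : F) : p.toFun (star a) = p.toFun a :=
  le_antisymm (by simpa using p.le_star (star a)) (p.le_star a)

/-- The *-algebra `F`, seen as a seminormed algebra through `p`. -/
@[nolint unusedArguments]
def Space (_p : CStarSeminorm F) : Type u := F

variable (p : CStarSeminorm F)

instance : Ring p.Space := inferInstanceAs (Ring F)
instance : StarRing p.Space := inferInstanceAs (StarRing F)
instance : Algebra ℂ p.Space := inferInstanceAs (Algebra ℂ F)
instance [StarModule ℂ F] : StarModule ℂ p.Space := inferInstanceAs (StarModule ℂ F)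

/-- The identity map from `F` to `F` with the seminorm `p`. -/
def toSpace : F →⋆ₐ[ℂ] p.Space := StarAlgHom.id ℂ F

/-- `p` as a seminorm of additive groups. -/
def toAddGroupSeminorm : AddGroupSeminorm p.Space where
  toFun := p.toFun
  map_zero' := p.zero'
  add_le' := p.add_le'
  neg' := p.neg'

instance : SeminormedRing p.Space where
  __ := p.toAddGroupSeminorm.toSeminormedAddCommGroup
  __ := (inferInstance : Ring p.Space)
  norm_mul_le := p.mul_le'

instance : NormedSpace ℂ p.Space where
  norm_smul_le c a := (p.smul' c a).le

instance : NormedStarGroup p.Space where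
  norm_star_le a := (p.star' a).le

/-- The Hausdorff completion of `F` with respect to `p`. -/
abbrev Compl : Type u := UniformSpace.Completion p.Space

open UniformSpace

theorem uniformContinuous_star : UniformContinuous (star : p.Space → p.Space) :=
  (starNormedAddGroupHom : NormedAddGroupHom p.Space p.Space).uniformContinuous

instance : Star p.Compl := ⟨Completion.map star⟩

theorem coe_star (a : p.Space) : ((star a : p.Space) : p.Compl) = star (a : p.Compl) :=
  (Completion.map_coe p.uniformContinuous_star a).symm

theorem continuous_star_compl : Continuous (star : p.Compl → p.Compl) :=
  Completion.continuous_map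

instance : ContinuousStar p.Compl := ⟨p.continuous_star_compl⟩

instance : StarRing p.Compl where
  star_involutive x := by
    induction x using Completion.induction_on with
    | hp => exact isClosed_eq (by fun_prop) (by fun_prop)
    | ih a => rw [← coe_star, ← coe_star, star_star]
  star_mul x y := by
    induction x, y using Completion.induction_on₂ with
    | hp => exact isClosed_eq (by fun_prop) (by fun_prop)
    | ih a b => rw [← Completion.coe_mul, ← coe_star, star_mul, Completion.coe_mul, coe_star,
        coe_star]
  star_add x y := by
    induction x, y using Completion.induction_on₂ with
    | hp => exact isClosed_eq (by fun_prop) (by fun_prop)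
    | ih a b => rw [← Completion.coe_add, ← coe_star, star_add, Completion.coe_add, coe_star,
        coe_star]

instance : CStarRing p.Compl where
  norm_mul_self_le x := by
    induction x using Completion.induction_on with
    | hp => exact isClosed_le (by fun_prop) (by fun_prop)
    | ih a =>
      rw [← coe_star, ← Completion.coe_mul, Completion.norm_coe, Completion.norm_coe, ← sq]
      exact (p.star_mul_self' a).ge

instance : NormedAlgebra ℂ p.Compl where
  norm_smul_le := norm_smul_le

theorem compl_star_smul [StarModule ℂ F] (c : ℂ) (x : p.Compl) : star (c • x) = star c • star x := by
  induction x using Completion.induction_on with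
  | hp =>
    exact isClosed_eq (p.continuous_star_compl.comp (continuous_const_smul c))
      (p.continuous_star_compl.const_smul (star c))
  | ih a => rw [← Completion.coe_smul, ← coe_star, star_smul, Completion.coe_smul, coe_star]

instance [StarModule ℂ F] : StarModule ℂ p.Compl := ⟨p.compl_star_smul⟩

instance [StarModule ℂ F] : CStarAlgebra p.Compl where

/-- The canonical map from `F` to its completion. -/
def toCompl : F →⋆ₐ[ℂ] p.Compl where
  toFun a := (p.toSpace a : p.Compl)
  map_one' := by rw [map_one]; rfl
  map_mul' a b := by rw [map_mul, Completion.coe_mul]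
  map_zero' := by rw [map_zero]; rfl
  map_add' a b := by rw [map_add, Completion.coe_add]
  commutes' c := by rw [AlgHomClass.commutes]; rfl
  map_star' a := by rw [map_star, coe_star]

theorem norm_toCompl (a : F) : ‖p.toCompl a‖ = p.toFun a :=
  Completion.norm_coe (p.toSpace a)

/-- The trivial C*-seminorm. -/
def zeroSeminorm : CStarSeminorm F where
  toFun _ := 0
  add_le' := by simp
  smul' := by simp
  mul_le' := by simp
  star_mul_self' := by simp

/-- The pointwise supremum of a pointwise bounded nonempty family of C*-seminorms. -/
def sup (S : Set (CStarSeminorm F)) (hne : S.Nonempty)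
    (hS : ∀ a, ∃ C : ℝ, ∀ p ∈ S, p.toFun a ≤ C) : CStarSeminorm F :=
  have : Nonempty S := hne.to_subtype
  have bdd : ∀ a, BddAbove (Set.range fun p : S => p.1.toFun a) := fun a => by
    obtain ⟨C, hC⟩ := hS a
    exact ⟨C, by rintro _ ⟨p, rfl⟩; exact hC _ p.2⟩
  have nn : ∀ a, 0 ≤ ⨆ p : S, p.1.toFun a := fun a => Real.iSup_nonneg fun p => p.1.nonneg' a
  { toFun := fun a => ⨆ p : S, p.1.toFun a
    add_le' := fun a b => ciSup_le fun p =>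
      (p.1.add_le' a b).trans (add_le_add (le_ciSup (bdd a) p) (le_ciSup (bdd b) p))
    smul' := fun c a => by
      simp only [CStarSeminorm.smul']
      rw [Real.mul_iSup_of_nonneg (norm_nonneg c)]
    mul_le' := fun a b => ciSup_le fun p => (p.1.mul_le' a b).trans
      (mul_le_mul (le_ciSup (bdd a) p) (le_ciSup (bdd b) p) (p.1.nonneg' b) (nn a))
    star_mul_self' := fun a => by
      apply le_antisymm
      · refine ciSup_le fun p => ?_
        rw [p.1.star_mul_self']
        exact pow_le_pow_left₀ (p.1.nonneg' a) (le_ciSup (bdd a) p) 2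
      · have h : (⨆ p : S, p.1.toFun a) ≤ √(⨆ p : S, p.1.toFun (star a * a)) := by
          refine ciSup_le fun p => Real.le_sqrt_of_sq_le ?_
          rw [← p.1.star_mul_self']
          exact le_ciSup (bdd (star a * a)) p
        calc (⨆ p : S, p.1.toFun a) ^ 2 ≤ √(⨆ p : S, p.1.toFun (star a * a)) ^ 2 :=
              pow_le_pow_left₀ (nn a) h 2
          _ = _ := Real.sq_sqrt (nn _) }

end CStarSeminorm

section OfRep

variable {F : Type u} [Ring F] [StarRing F] [Algebra ℂ F]
variable {E : Type v} [NormedAddCommGroup E] [InnerProductSpace ℂ E]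

/-- A *-representation `Φ` of `F` by bounded operators on a pre-Hilbert space gives the
C*-seminorm `x ↦ ‖Φ x‖`. -/
def CStarSeminorm.ofRep (Φ : F →ₗ[ℂ] (E →L[ℂ] E)) (hmul : ∀ x y, Φ (x * y) = Φ x * Φ y)
    (hstar : ∀ x v w, inner ℂ (Φ (star x) v) w = inner ℂ v (Φ x w)) : CStarSeminorm F :=
  have sq_le : ∀ x, ‖Φ x‖ ^ 2 ≤ ‖Φ (star x * x)‖ := fun x => by
    have h : ‖Φ x‖ ≤ √‖Φ (star x * x)‖ := by
      refine ContinuousLinearMap.opNorm_le_bound _ (Real.sqrt_nonneg _) fun v => ?_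
      refine abs_le_of_sq_le_sq' ?_ (by positivity) |>.2
      have e : Φ (star x) (Φ x v) = Φ (star x * x) v := by
        rw [hmul]
        rfl
      rw [mul_pow, Real.sq_sqrt (norm_nonneg _), ← inner_self_eq_norm_sq (𝕜 := ℂ), ← hstar, e]
      refine (re_inner_le_norm _ _).trans ?_
      rw [sq, ← mul_assoc]
      exact mul_le_mul_of_nonneg_right (ContinuousLinearMap.le_opNorm _ _) (norm_nonneg _)
    calc _ ≤ √‖Φ (star x * x)‖ ^ 2 := pow_le_pow_left₀ (norm_nonneg _) h 2
      _ = _ := Real.sq_sqrt (norm_nonneg _)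
  have star_le : ∀ x, ‖Φ (star x)‖ ≤ ‖Φ x‖ := fun x => by
    have h := sq_le (star x)
    rw [star_star, hmul] at h
    have h2 := h.trans (norm_mul_le _ _)
    rcases (norm_nonneg (Φ (star x))).eq_or_lt with h0 | h0
    · rw [← h0]
      exact norm_nonneg _
    · nlinarith
  { toFun := fun x => ‖Φ x‖
    add_le' := fun x y => by
      rw [map_add]
      exact norm_add_le _ _
    smul' := fun c x => by rw [map_smul, norm_smul]
    mul_le' := fun x y => by
      rw [hmul]
      exact norm_mul_le _ _
    star_mul_self' := fun x => by
      refine le_antisymm ?_ (sq_le x)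
      rw [hmul, sq]
      exact (norm_mul_le _ _).trans
        (mul_le_mul_of_nonneg_right (star_le x) (norm_nonneg _)) }

end OfRep

/-! ### The minimal tensor product -/

section MinTensor

variable {A : Type u} [CStarAlgebra A] {B : Type v} [CStarAlgebra B]
variable {H : Type u} [NormedAddCommGroup H] [InnerProductSpace ℂ H] [CompleteSpace H]
variable {K : Type v} [NormedAddCommGroup K] [InnerProductSpace ℂ K] [CompleteSpace K]

/-- The tensor product of two representations, acting on the algebraic tensor product of the two
Hilbert spaces (a pre-Hilbert space). -/
def tensorRep (π : A →⋆ₐ[ℂ] (H →L[ℂ] H)) (ρ : B →⋆ₐ[ℂ] (K →L[ℂ] K)) :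
    A ⊗[ℂ] B →ₗ[ℂ] ((H ⊗[ℂ] K) →L[ℂ] (H ⊗[ℂ] K)) :=
  TensorProduct.lift (LinearMap.mk₂ ℂ (fun a b => TensorProduct.mapL (π a) (ρ b))
    (fun a a' b => by rw [map_add, TensorProduct.mapL_add_left])
    (fun c a b => by rw [map_smul, TensorProduct.mapL_smul_left])
    (fun a b b' => by rw [map_add, TensorProduct.mapL_add_right])
    (fun c a b => by rw [map_smul, TensorProduct.mapL_smul_right]))

variable (π : A →⋆ₐ[ℂ] (H →L[ℂ] H)) (ρ : B →⋆ₐ[ℂ] (K →L[ℂ] K))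

theorem tensorRep_tmul (a : A) (b : B) :
    tensorRep π ρ (a ⊗ₜ b) = TensorProduct.mapL (π a) (ρ b) := rfl

theorem tensorRep_mul (x y : A ⊗[ℂ] B) :
    tensorRep π ρ (x * y) = tensorRep π ρ x * tensorRep π ρ y := by
  induction x with
  | zero => simp
  | add x x' hx hx' => rw [add_mul, map_add, hx, hx', map_add, add_mul]
  | tmul a b =>
    induction y with
    | zero => simp
    | add y y' hy hy' => rw [mul_add, map_add, hy, hy', map_add, mul_add]
    | tmul a' b' =>
      rw [Algebra.TensorProduct.tmul_mul_tmul, tensorRep_tmul, tensorRep_tmul, tensorRep_tmul,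
        map_mul, map_mul, TensorProduct.mapL_mul]

theorem tensorRep_star_tmul (a : A) (b : B) (v w : H ⊗[ℂ] K) :
    inner ℂ (tensorRep π ρ (star (a ⊗ₜ b)) v) w = inner ℂ v (tensorRep π ρ (a ⊗ₜ b) w) := by
  rw [TensorProduct.star_tmul, tensorRep_tmul, tensorRep_tmul]
  induction v with
  | zero => simp
  | add v v' hv hv' => rw [map_add, inner_add_left, hv, hv', inner_add_left]
  | tmul h k =>
    induction w with
    | zero => simp
    | add w w' hw hw' => rw [map_add, inner_add_right, hw, hw', inner_add_right]
    | tmul h' k' =>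
      rw [TensorProduct.mapL_tmul, TensorProduct.mapL_tmul, TensorProduct.inner_tmul,
        TensorProduct.inner_tmul, map_star, map_star, ContinuousLinearMap.star_eq_adjoint,
        ContinuousLinearMap.star_eq_adjoint, ContinuousLinearMap.adjoint_inner_left,
        ContinuousLinearMap.adjoint_inner_left]

theorem tensorRep_star (x : A ⊗[ℂ] B) (v w : H ⊗[ℂ] K) :
    inner ℂ (tensorRep π ρ (star x) v) w = inner ℂ v (tensorRep π ρ x w) := by
  induction x with
  | zero => simp
  | add x x' hx hx' =>
    rw [star_add, map_add, map_add, add_apply, add_apply,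
      inner_add_left, inner_add_right, hx, hx']
  | tmul a b => exact tensorRep_star_tmul π ρ a b v w

/-- The C*-seminorm `x ↦ ‖(π ⊗ ρ)(x)‖` on the algebraic tensor product. -/
def tensorRepSeminorm : CStarSeminorm (A ⊗[ℂ] B) :=
  CStarSeminorm.ofRep (tensorRep π ρ) (tensorRep_mul π ρ) (tensorRep_star π ρ)

variable (A B)

/-- All the C*-seminorms coming from pairs of representations of `A` and `B`. -/
def tensorRepSeminorms : Set (CStarSeminorm (A ⊗[ℂ] B)) :=
  {p | ∃ (H : Type u) (_ : NormedAddCommGroup H) (_ : InnerProductSpace ℂ H) (_ : CompleteSpace H)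
    (K : Type v) (_ : NormedAddCommGroup K) (_ : InnerProductSpace ℂ K) (_ : CompleteSpace K)
    (π : A →⋆ₐ[ℂ] (H →L[ℂ] H)) (ρ : B →⋆ₐ[ℂ] (K →L[ℂ] K)), p = tensorRepSeminorm π ρ}

theorem tensorRepSeminorms_nonempty : (tensorRepSeminorms A B).Nonempty :=
  ⟨_, PUnit, inferInstance, inferInstance, inferInstance, PUnit, inferInstance, inferInstance,
    inferInstance,
    { toFun := fun _ => 0
      map_one' := Subsingleton.elim _ _
      map_mul' := fun _ _ => Subsingleton.elim _ _
      map_zero' := rfl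
      map_add' := fun _ _ => Subsingleton.elim _ _
      commutes' := fun _ => Subsingleton.elim _ _
      map_star' := fun _ => Subsingleton.elim _ _ },
    { toFun := fun _ => 0
      map_one' := Subsingleton.elim _ _
      map_mul' := fun _ _ => Subsingleton.elim _ _
      map_zero' := rfl
      map_add' := fun _ _ => Subsingleton.elim _ _
      commutes' := fun _ => Subsingleton.elim _ _
      map_star' := fun _ => Subsingleton.elim _ _ }, rfl⟩

theorem tensorRepSeminorms_bdd (x : A ⊗[ℂ] B) :
    ∃ C : ℝ, ∀ p ∈ tensorRepSeminorms A B, p.toFun x ≤ C := by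
  induction x with
  | zero => exact ⟨0, fun p _ => p.zero'.le⟩
  | add x y hx hy =>
    obtain ⟨C, hC⟩ := hx
    obtain ⟨D, hD⟩ := hy
    exact ⟨C + D, fun p hp => (p.add_le' x y).trans (add_le_add (hC p hp) (hD p hp))⟩
  | tmul a b =>
    refine ⟨‖a‖ * ‖b‖, ?_⟩
    rintro _ ⟨H, _, _, _, K, _, _, _, π, ρ, rfl⟩
    refine (TensorProduct.norm_mapL_le (π a) (ρ b)).trans ?_
    exact mul_le_mul (NonUnitalStarAlgHom.norm_apply_le π a)
      (NonUnitalStarAlgHom.norm_apply_le ρ b) (norm_nonneg _) (norm_nonneg _)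

/-- The minimal (spatial) C*-norm on the algebraic tensor product:
the supremum of `‖(π ⊗ ρ)(x)‖` over all representations `π` of `A` and `ρ` of `B`. -/
def minTensorNorm : CStarSeminorm (A ⊗[ℂ] B) :=
  CStarSeminorm.sup (tensorRepSeminorms A B) (tensorRepSeminorms_nonempty A B)
    (tensorRepSeminorms_bdd A B)

/-- The minimal tensor product of two C*-algebras. -/
abbrev MinTensor : Type (max u v) := (minTensorNorm A B).Compl

/-- The canonical map of the algebraic tensor product into the minimal tensor product. -/
def toMinTensor : A ⊗[ℂ] B →⋆ₐ[ℂ] MinTensor A B := (minTensorNorm A B).toCompl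

end MinTensor

/-! ### The free *-algebra on self-adjoint generators -/

/-- The free unital complex *-algebra on a set `X` of self-adjoint generators. -/
def FreeStar (X : Type u) : Type u := FreeAlgebra ℂ X

namespace FreeStar

variable {X : Type u}

instance : Ring (FreeStar X) := inferInstanceAs (Ring (FreeAlgebra ℂ X))
instance : Algebra ℂ (FreeStar X) := inferInstanceAs (Algebra ℂ (FreeAlgebra ℂ X))

/-- The generators. -/
def gen (x : X) : FreeStar X := FreeAlgebra.ι ℂ x

/-- The antimultiplicative conjugate-linear map fixing the generators. -/
def starOp : FreeStar X →+* (FreeStar X)ᵐᵒᵖ :=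
  letI : Algebra ℂ (FreeStar X)ᵐᵒᵖ := Algebra.compHom _ (starRingEnd ℂ)
  (FreeAlgebra.lift ℂ (fun x : X => MulOpposite.op (gen x)) :
    FreeAlgebra ℂ X →ₐ[ℂ] (FreeStar X)ᵐᵒᵖ).toRingHom

theorem starOp_gen (x : X) : starOp (gen x) = MulOpposite.op (gen x) :=
  letI : Algebra ℂ (FreeStar X)ᵐᵒᵖ := Algebra.compHom _ (starRingEnd ℂ)
  FreeAlgebra.lift_ι_apply (A := (FreeStar X)ᵐᵒᵖ) (R := ℂ) (fun x : X => MulOpposite.op (gen x)) x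

theorem starOp_algebraMap (c : ℂ) : starOp (algebraMap ℂ (FreeStar X) c) =
    MulOpposite.op (algebraMap ℂ (FreeStar X) (star c)) :=
  letI : Algebra ℂ (FreeStar X)ᵐᵒᵖ := Algebra.compHom _ (starRingEnd ℂ)
  AlgHom.commutes (FreeAlgebra.lift ℂ (fun x : X => MulOpposite.op (gen x)) :
    FreeAlgebra ℂ X →ₐ[ℂ] (FreeStar X)ᵐᵒᵖ) c

/-- Induction on elements of the free *-algebra. -/
theorem induction' {P : FreeStar X → Prop} (hc : ∀ c : ℂ, P (algebraMap ℂ _ c))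
    (hg : ∀ x, P (gen x)) (hm : ∀ a b, P a → P b → P (a * b)) (ha : ∀ a b, P a → P b → P (a + b))
    (a : FreeStar X) : P a :=
  FreeAlgebra.induction ℂ X (motive := P) hc hg hm ha a

instance : StarRing (FreeStar X) where
  star a := (starOp a).unop
  star_involutive a := by
    induction a using induction' with
    | hc c =>
      change (starOp (starOp _).unop).unop = _
      rw [starOp_algebraMap, MulOpposite.unop_op, starOp_algebraMap, MulOpposite.unop_op, star_star]
    | hg x =>
      change (starOp (starOp _).unop).unop = _
      rw [starOp_gen, MulOpposite.unop_op, starOp_gen, MulOpposite.unop_op]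
    | hm a b h1 h2 =>
      change (starOp (starOp _).unop).unop = _
      rw [map_mul, MulOpposite.unop_mul, map_mul, MulOpposite.unop_mul]
      exact congrArg₂ _ h1 h2
    | ha a b h1 h2 =>
      change (starOp (starOp _).unop).unop = _
      rw [map_add, MulOpposite.unop_add, map_add, MulOpposite.unop_add]
      exact congrArg₂ _ h1 h2
  star_mul a b := by
    rw [map_mul, MulOpposite.unop_mul]
  star_add a b := by
    rw [map_add, MulOpposite.unop_add]

theorem star_gen (x : X) : star (gen x) = gen x := congrArg MulOpposite.unop (starOp_gen x)

instance : StarModule ℂ (FreeStar X) where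
  star_smul c a := by
    rw [Algebra.smul_def, star_mul, Algebra.smul_def, Algebra.commutes (star c)]
    congr 1
    exact congrArg MulOpposite.unop (starOp_algebraMap c)

end FreeStar

/-! ### Partitions and their formal linear combinations -/

/-- Partitions of `k` upper and `l` lower points; the blocks are the classes of the
equivalence relation. -/
abbrev Partn (k l : ℕ) : Type := Setoid (Fin k ⊕ Fin l)

namespace Partn

variable {k l m k' l' : ℕ}

/-- The tensor product: the two partitions side by side. -/
abbrev tens (p : Partn k l) (q : Partn k' l') : Partn (k + k') (l + l') :=
  p.map (Sum.map (Fin.castAdd k') (Fin.castAdd l')) ⊔ q.map (Sum.map (Fin.natAdd k) (Fin.natAdd l))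

/-- The diagram with `q` below `p`, the lower row of `p` being identified with the upper row
of `q`. -/
def glue (q : Partn l m) (p : Partn k l) : Setoid (Fin k ⊕ (Fin l ⊕ Fin m)) :=
  p.map (Sum.map id Sum.inl) ⊔ q.map Sum.inr

/-- The inclusion of the upper row of `p` and the lower row of `q` in the glued diagram. -/
def outer (k l m : ℕ) : Fin k ⊕ Fin m → Fin k ⊕ (Fin l ⊕ Fin m) := Sum.map id Sum.inr

/-- The partition underlying the composition. -/
abbrev compPart (q : Partn l m) (p : Partn k l) : Partn k m := (glue q p).comap (outer k l m)

/-- The number of components of the glued diagram that are not connected to any of the remaining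
upper and lower points. -/
def loops (q : Partn l m) (p : Partn k l) : ℕ :=
  Nat.card {c : Quotient (glue q p) // ∀ x, Quotient.mk _ (outer k l m x) ≠ c}

/-- Reflection at the horizontal axis. -/
abbrev flip (p : Partn k l) : Partn l k := p.comap Sum.swap

open Classical in
/-- `δ_p(i, j)`: it is `1` if points in the same block carry the same number. -/
def delta {N : ℕ} (p : Partn k l) (i : Fin k → Fin N) (j : Fin l → Fin N) : ℂ :=
  if ∀ x y, p x y → (Sum.elim i j x : Fin N) = Sum.elim i j y then 1 else 0

end Partn

/-- Formal complex linear combinations of partitions of `k` upper and `l` lower points. -/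
abbrev PLin (k l : ℕ) : Type := Partn k l →₀ ℂ

namespace PLin

variable {k l m k' l' : ℕ}

/-- A partition as a linear combination. -/
def of (p : Partn k l) : PLin k l := Finsupp.single p 1

/-- The bilinear tensor product. -/
def tens : PLin k l →ₗ[ℂ] PLin k' l' →ₗ[ℂ] PLin (k + k') (l + l') :=
  Finsupp.linearCombination ℂ fun p => Finsupp.linearCombination ℂ fun q => of (p.tens q)

/-- The bilinear composition `comp N q p = q p`, every removed component giving a factor `N`. -/
def comp (N : ℕ) : PLin l m →ₗ[ℂ] PLin k l →ₗ[ℂ] PLin k m :=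
  Finsupp.linearCombination ℂ fun q => Finsupp.linearCombination ℂ fun p =>
    (N : ℂ) ^ q.loops p • of (q.compPart p)

/-- The antilinear involution. -/
def adj (p : PLin k l) : PLin l k :=
  (p.mapRange (starRingEnd ℂ) (map_zero _)).mapDomain Partn.flip

/-- The identity partition on one point. -/
def idPart : PLin 1 1 := of ⊤

/-- The pair partition with two lower points. -/
def pairPart : PLin 0 2 := of ⊤

/-- One upper and one lower point, which are not connected. -/
def disc : PLin 1 1 := of ⊥

/-- The double singleton with two lower points. -/
def doubleSingleton : PLin 0 2 := of ⊥

/-- Tensor powers of an element of `PLin 1 1`; the zeroth one is the empty partition. -/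
def tensPow (p : PLin 1 1) : (n : ℕ) → PLin n n
  | 0 => of ⊤
  | n + 1 => tens (tensPow p n) p

/-- `τ = id - (2/N) disc`. -/
def tau (N : ℕ) : PLin 1 1 := idPart - (2 / (N : ℂ)) • disc

/-- The linear map `p ↦ τ^{⊗l} p τ^{⊗k}`. -/
def conjTau (N k l : ℕ) : PLin k l →ₗ[ℂ] PLin k l :=
  comp N (tensPow (tau N) l) ∘ₗ (comp N).flip (tensPow (tau N) k)

/-- The matrix of the linear map `T_p : (ℂ^N)^{⊗k} → (ℂ^N)^{⊗l}` in the standard bases. -/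
def T (N : ℕ) : PLin k l →ₗ[ℂ] Matrix (Fin l → Fin N) (Fin k → Fin N) ℂ :=
  Finsupp.linearCombination ℂ fun p => Matrix.of fun j i => p.delta i j

end PLin

/-- Linear categories of partitions with parameter `N`. -/
structure LinCat (N : ℕ) where
  hom : ∀ k l : ℕ, Submodule ℂ (PLin k l)
  id_mem : PLin.idPart ∈ hom 1 1
  pair_mem : PLin.pairPart ∈ hom 0 2
  tens_mem : ∀ {k l k' l' : ℕ} {p : PLin k l} {q : PLin k' l'}, p ∈ hom k l → q ∈ hom k' l' →
    PLin.tens p q ∈ hom (k + k') (l + l')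
  comp_mem : ∀ {k l m : ℕ} {q : PLin l m} {p : PLin k l}, q ∈ hom l m → p ∈ hom k l →
    PLin.comp N q p ∈ hom k m
  adj_mem : ∀ {k l : ℕ} {p : PLin k l}, p ∈ hom k l → p.adj ∈ hom l k

namespace LinCat

variable {N : ℕ}

/-- The category of all linear combinations of partitions. -/
def all (N : ℕ) : LinCat N where
  hom _ _ := ⊤
  id_mem := trivial
  pair_mem := trivial
  tens_mem _ _ := trivial
  comp_mem _ _ := trivial
  adj_mem _ := trivial

/-- The smallest linear category of partitions containing `p`. -/
def generate (N : ℕ) {k l : ℕ} (p : PLin k l) : LinCat N where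
  hom k' l' := ⨅ K : {K : LinCat N // p ∈ K.hom k l}, K.1.hom k' l'
  id_mem := (Submodule.mem_iInf _).2 fun K => K.1.id_mem
  pair_mem := (Submodule.mem_iInf _).2 fun K => K.1.pair_mem
  tens_mem hp hq := (Submodule.mem_iInf _).2 fun K =>
    K.1.tens_mem ((Submodule.mem_iInf _).1 hp K) ((Submodule.mem_iInf _).1 hq K)
  comp_mem hq hp := (Submodule.mem_iInf _).2 fun K =>
    K.1.comp_mem ((Submodule.mem_iInf _).1 hq K) ((Submodule.mem_iInf _).1 hp K)
  adj_mem hp := (Submodule.mem_iInf _).2 fun K => K.1.adj_mem ((Submodule.mem_iInf _).1 hp K)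

/-- The linear maps `F k l` restrict to a monoidal *-isomorphism from `K` to `L` (which is the
identity on the objects `0, 1, 2, …`). -/
structure IsMonoidalStarIso (K L : LinCat N) (F : ∀ k l : ℕ, PLin k l →ₗ[ℂ] PLin k l) : Prop where
  bijOn : ∀ k l, Set.BijOn (F k l) (K.hom k l) (L.hom k l)
  map_id : ∀ k, F k k (PLin.tensPow PLin.idPart k) = PLin.tensPow PLin.idPart k
  map_tens : ∀ {k l k' l' : ℕ}, ∀ p ∈ K.hom k l, ∀ q ∈ K.hom k' l',
    F (k + k') (l + l') (PLin.tens p q) = PLin.tens (F k l p) (F k' l' q)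
  map_comp : ∀ {k l m : ℕ}, ∀ q ∈ K.hom l m, ∀ p ∈ K.hom k l,
    F k m (PLin.comp N q p) = PLin.comp N (F l m q) (F k l p)
  map_adj : ∀ {k l : ℕ}, ∀ p ∈ K.hom k l, F l k p.adj = (F k l p).adj

end LinCat

/-! ### Compact matrix quantum groups -/

/-- A scalar matrix as a matrix over a complex algebra. -/
def scalarMat {ι κ : Type*} (A : Type*) [Ring A] [Algebra ℂ A] (T : Matrix ι κ ℂ) : Matrix ι κ A :=
  T.map (algebraMap ℂ A)

/-- The tensor power `u^{⊗k}`, its rows and columns being indexed by multi-indices. -/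
def tensorPower {N : ℕ} {A : Type*} [Ring A] (u : Matrix (Fin N) (Fin N) A) (k : ℕ) :
    Matrix (Fin k → Fin N) (Fin k → Fin N) A :=
  Matrix.of fun i j => (List.ofFn fun r => u (i r) (j r)).prod

/-- A unital C*-algebra together with an `N × N` matrix over it. -/
structure MatrixPair (N : ℕ) where
  A : Type u
  [cstar : CStarAlgebra A]
  u : Matrix (Fin N) (Fin N) A

attribute [instance] MatrixPair.cstar

namespace MatrixPair

variable {N : ℕ}

/-- Compact matrix quantum groups. -/
structure IsCMQG (G : MatrixPair.{u} N) : Prop where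
  generates : (StarAlgebra.adjoin ℂ {a : G.A | ∃ i j, a = G.u i j}).topologicalClosure = ⊤
  isUnit : IsUnit G.u
  isUnit_transpose : IsUnit G.u.transpose
  comul : ∃ Δ : G.A →⋆ₐ[ℂ] MinTensor G.A G.A,
    ∀ i j, Δ (G.u i j) = toMinTensor G.A G.A (∑ k, G.u i k ⊗ₜ[ℂ] G.u k j)

/-- `H` is a quantum subgroup of `G`. -/
def IsSubgroup (H : MatrixPair.{u} N) (G : MatrixPair.{v} N) : Prop :=
  ∃ φ : G.A →⋆ₐ[ℂ] H.A, Function.Surjective φ ∧ ∀ i j, φ (G.u i j) = H.u i j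

/-- `G` and `H` are identical. -/
def Identical (G : MatrixPair.{u} N) (H : MatrixPair.{v} N) : Prop :=
  ∃ φ : G.A ≃⋆ₐ[ℂ] H.A, ∀ i j, φ (G.u i j) = H.u i j

/-- `T G T⁻¹`, the pair `(C(G), T u T⁻¹)`. -/
def conj (T : Matrix (Fin N) (Fin N) ℂ) (G : MatrixPair.{u} N) : MatrixPair.{u} N where
  A := G.A
  u := scalarMat G.A T * G.u * scalarMat G.A T⁻¹

/-- The intertwiners from `u^{⊗k}` to `u^{⊗l}`. -/
def Mor (G : MatrixPair.{u} N) (k l : ℕ) : Set (Matrix (Fin l → Fin N) (Fin k → Fin N) ℂ) :=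
  {T | scalarMat G.A T * tensorPower G.u k = tensorPower G.u l * scalarMat G.A T}

/-- `G` corresponds to the linear category of partitions `K`. -/
def Corresponds (G : MatrixPair.{u} N) (K : LinCat N) : Prop :=
  ∀ k l, G.Mor k l = PLin.T N '' (K.hom k l : Set (PLin k l))

/-- The symmetric group: functions on the permutations, `u i j` being the `(i,j)` entry of the
permutation matrix. -/
def symmetricGroup (N : ℕ) : MatrixPair.{0} N where
  A := Equiv.Perm (Fin N) → ℂ
  u := Matrix.of fun i j σ => if i = σ j then 1 else 0

/-! ### Universal C*-algebras of orthogonal matrices -/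

/-- The generic matrix of self-adjoint generators. -/
def genMat (N : ℕ) : Matrix (Fin N) (Fin N) (FreeStar (Fin N × Fin N)) :=
  Matrix.of fun i j => FreeStar.gen (i, j)

/-- The relations `u uᵗ = uᵗ u = 1`. -/
def orthRel (N : ℕ) : Set (FreeStar (Fin N × Fin N)) :=
  {a | ∃ i j, a = (genMat N * (genMat N).transpose - 1) i j ∨
    a = ((genMat N).transpose * genMat N - 1) i j}

/-- The C*-seminorms in which the relations `u uᵗ = uᵗ u = 1` and the relations in `R` hold. -/
def relSeminorms (N : ℕ) (R : Set (FreeStar (Fin N × Fin N))) :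
    Set (CStarSeminorm (FreeStar (Fin N × Fin N))) :=
  {p | ∀ a ∈ orthRel N ∪ R, p.toFun a = 0}

theorem relSeminorms_nonempty (N : ℕ) (R : Set (FreeStar (Fin N × Fin N))) :
    (relSeminorms N R).Nonempty :=
  ⟨CStarSeminorm.zeroSeminorm, fun _ _ => rfl⟩

theorem relSeminorms_gen_le (N : ℕ) (R : Set (FreeStar (Fin N × Fin N)))
    {p : CStarSeminorm (FreeStar (Fin N × Fin N))} (hp : p ∈ relSeminorms N R) (x : Fin N × Fin N) :
    p.toFun (FreeStar.gen x) ≤ 1 := by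
  let _ : PartialOrder p.Compl := CStarAlgebra.spectralOrder _
  have : StarOrderedRing p.Compl := CStarAlgebra.spectralOrderedRing _
  obtain ⟨i, j⟩ := x
  let a : Fin N → p.Compl := fun k => p.toCompl (FreeStar.gen (i, k))
  have ha : ∀ k, star (a k) = a k := fun k => by
    simp only [a]
    rw [← map_star, FreeStar.star_gen]
  have hsum : ∑ k, star (a k) * a k = 1 := by
    have h := hp _ (Or.inl ⟨i, i, Or.inl rfl⟩)
    rw [← p.norm_toCompl, norm_eq_zero, Matrix.sub_apply, Matrix.mul_apply, Matrix.one_apply_eq,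
      map_sub, map_one, sub_eq_zero, map_sum] at h
    rw [← h]
    refine Finset.sum_congr rfl fun k _ => ?_
    rw [ha, ← map_mul]
    rfl
  have hle : star (a j) * a j ≤ 1 := by
    rw [← hsum]
    exact Finset.single_le_sum (f := fun k => star (a k) * a k)
      (fun k _ => star_mul_self_nonneg (a k)) (Finset.mem_univ j)
  have h1 : ‖star (a j) * a j‖ ≤ ‖(1 : p.Compl)‖ :=
    CStarAlgebra.norm_le_norm_of_nonneg_of_le (star_mul_self_nonneg _) hle
  have h2 : ‖(1 : p.Compl)‖ ≤ 1 := by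
    have h := CStarRing.norm_star_mul_self (x := (1 : p.Compl))
    rw [star_one, one_mul] at h
    by_contra hc
    nlinarith
  rw [CStarRing.norm_star_mul_self] at h1
  have h3 : ‖a j‖ ≤ 1 := by
    by_contra hc
    nlinarith
  rwa [← p.norm_toCompl]

theorem relSeminorms_bdd (N : ℕ) (R : Set (FreeStar (Fin N × Fin N)))
    (a : FreeStar (Fin N × Fin N)) : ∃ C : ℝ, ∀ p ∈ relSeminorms N R, p.toFun a ≤ C := by
  induction a using FreeStar.induction' with
  | hc c =>
    refine ⟨‖c‖, fun p _ => ?_⟩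
    have h : p.toFun 1 ≤ 1 := by
      have h := p.star_mul_self' 1
      rw [star_one, one_mul] at h
      by_contra hc
      nlinarith
    rw [Algebra.algebraMap_eq_smul_one, p.smul']
    nlinarith [norm_nonneg c]
  | hg x => exact ⟨1, fun p hp => relSeminorms_gen_le N R hp x⟩
  | hm a b h1 h2 =>
    obtain ⟨C, hC⟩ := h1
    obtain ⟨D, hD⟩ := h2
    exact ⟨C * D, fun p hp => (p.mul_le' a b).trans (mul_le_mul (hC p hp) (hD p hp) (p.nonneg' b)
      ((p.nonneg' a).trans (hC p hp)))⟩
  | ha a b h1 h2 =>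
    obtain ⟨C, hC⟩ := h1
    obtain ⟨D, hD⟩ := h2
    exact ⟨C + D, fun p hp => (p.add_le' a b).trans (add_le_add (hC p hp) (hD p hp))⟩

/-- The largest C*-seminorm in which the relations hold. -/
def relSeminorm (N : ℕ) (R : Set (FreeStar (Fin N × Fin N))) :
    CStarSeminorm (FreeStar (Fin N × Fin N)) :=
  CStarSeminorm.sup (relSeminorms N R) (relSeminorms_nonempty N R) (relSeminorms_bdd N R)

/-- The universal C*-algebra
`C*(u i j | u i j = (u i j)*, u uᵗ = uᵗ u = 1, a = 0 for all a in R)` with its matrix `u`. -/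
def universal (N : ℕ) (R : Set (FreeStar (Fin N × Fin N))) : MatrixPair.{0} N where
  A := (relSeminorm N R).Compl
  u := (genMat N).map (relSeminorm N R).toCompl

/-- The free orthogonal quantum group `O_N^+`. -/
def freeOrthogonal (N : ℕ) : MatrixPair.{0} N := universal N ∅

/-- The quantum group given by a linear category of partitions: the additional relations are
`T_p u^{⊗k} = u^{⊗l} T_p` for all `p` in the category. -/
def ofCategory {N : ℕ} (K : LinCat N) : MatrixPair.{0} N :=
  universal N {a | ∃ (k l : ℕ), ∃ p ∈ K.hom k l, ∃ (j : Fin l → Fin N) (i : Fin k → Fin N),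
    a = (scalarMat (FreeStar (Fin N × Fin N)) (PLin.T N p) * tensorPower (genMat N) k -
      tensorPower (genMat N) l * scalarMat (FreeStar (Fin N × Fin N)) (PLin.T N p)) j i}

/-- The quantum group `B_N^{#+}`, given by the category generated by the double singleton. -/
def freeBistochasticSharp (N : ℕ) : MatrixPair.{0} N :=
  ofCategory (LinCat.generate N PLin.doubleSingleton)

/-- The matrix `T_τ` of size `N × N`. -/
def tauMat (N : ℕ) : Matrix (Fin N) (Fin N) ℂ :=
  Matrix.of fun i j => PLin.T N (PLin.tau N) (fun _ => i) (fun _ => j)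

/-! ### The quantum groups generated by the subrepresentation -/

/-- The orthogonal matrix `U_{(N,±)}` for `N = n + 1`; the sign is `ε`. -/
def irrU (n : ℕ) (ε : ℤˣ) : Matrix (Fin (n + 1)) (Fin (n + 1)) ℂ :=
  Matrix.of fun i j =>
    if i = Fin.last n ∨ j = Fin.last n then ((ε : ℤ) : ℂ) * (1 / (√((n : ℝ) + 1) : ℝ))
    else (if i = j then 1 else 0) - 1 / (n : ℂ) * (1 + ((ε : ℤ) : ℂ) * (1 / (√((n : ℝ) + 1) : ℝ)))

/-- The matrix `V_{(N,±)}` for `N = n + 1`: the first `n` rows of `U_{(N,±)}`. -/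
def irrV (n : ℕ) (ε : ℤˣ) : Matrix (Fin n) (Fin (n + 1)) ℂ :=
  Matrix.of fun i j => irrU n ε i.castSucc j

/-- The matrix `V u V*`. -/
def compressMat {n : ℕ} (V : Matrix (Fin n) (Fin N) ℂ) (G : MatrixPair.{u} N) :
    Matrix (Fin n) (Fin n) G.A :=
  scalarMat G.A V * G.u * scalarMat G.A V.conjTranspose

/-- The C*-subalgebra generated by the entries of `V u V*`. -/
def compressAlg {n : ℕ} (V : Matrix (Fin n) (Fin N) ℂ) (G : MatrixPair.{u} N) :
    StarSubalgebra ℂ G.A :=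
  (StarAlgebra.adjoin ℂ {a : G.A | ∃ i j, a = compressMat V G i j}).topologicalClosure

/-- `V G V*`: the C*-subalgebra generated by the entries of `V u V*`, with the matrix `V u V*`. -/
def compress {n : ℕ} (V : Matrix (Fin n) (Fin N) ℂ) (G : MatrixPair.{u} N) :
    MatrixPair.{u} n where
  A := compressAlg V G
  cstar := StarSubalgebra.cstarAlgebra (compressAlg V G)
    (h_closed := StarSubalgebra.isClosed_topologicalClosure _)
  u := Matrix.of fun i j => ⟨compressMat V G i j,
    StarSubalgebra.le_topologicalClosure _ (StarAlgebra.subset_adjoin ℂ _ ⟨i, j, rfl⟩)⟩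

/-- `G^irr_±` for a quantum group with fundamental representation of size `n + 1`. -/
def irr {n : ℕ} (ε : ℤˣ) (G : MatrixPair.{u} (n + 1)) : MatrixPair.{u} n :=
  compress (irrV n ε) G

end MatrixPair

end

/-! Everything rests on one element. Since `d` composed with itself is `N d`, the element `τ = id -
(2/N) d` is self-adjoint and squares to `id`; its matrix is the real symmetric reflection `1 - (2/N)
J`, with `J` the all-ones matrix. Hence `p ↦ τ^{⊗l} p τ^{⊗k}` is its own inverse, and it is
compatible with composition because the two inner copies of `τ` cancel (`PLin.conjTau_comp`). It
fixes the pair partition because `T_τ` is orthogonal (`PLin.conjTau_pairPart`). So it carries linear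
categories of partitions to linear categories of partitions.

The rules of the diagram calculus (associativity, interchange, units, adjoints) are read off from
matrices. For a single `N` the map `p ↦ T_p` need not be injective. But each rule compares two
expressions which, for every `N`, are a power of `N` times a partition independent of `N`, and such
a family is determined by its matrices for all `N` together (`PLin.IsMonomial.ext`). The input is
that `T` respects composition, where the factor `N^loops` counts the free labellings of removed
components (`Partn.sum_delta_mul_delta`).

On the quantum group side, replacing `u` by `T_τ u T_τ⁻¹` conjugates all intertwiner spaces by
tensor powers of `T_τ`, so the correspondence with a category is transported
(`MatrixPair.Corresponds.conj_tau`). The bounds by `S_N` and `O_N^+` survive because permutation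
matrices commute with `J` and because `u ↦ T_τ u T_τ` is an involution of `C(O_N^+)`.

If the double singleton is an intertwiner, all products of two row sums of `u` are `1`. With
orthogonality this makes all row and column sums equal to one element, so `u` commutes with `J` and
with `T_τ`, and conjugation changes nothing (`MatrixPair.scalarMat_tau_comm`). The last part reduces
to the scalar identity `T_τ V_± = V_∓` in size `N - 1` (`MatrixPair.tauMat_mul_irrV`). -/

namespace Partn

/-! ### Labellings of partitions and the counting of removed components -/

variable {k l m k' l' : ℕ} {N : ℕ}

/-- The pushforward of a setoid is the equivalence relation generated by the image pairs, so an
inclusion need only be tested on generators. -/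
theorem map_le_iff {α β : Type*} {r : Setoid α} {f : α → β} {s : Setoid β} :
    r.map f ≤ s ↔ r ≤ s.comap f := by
  constructor
  · exact fun h => le_trans Setoid.le_comap_map fun x y hxy => h hxy
  · intro h x y hxy
    change Relation.EqvGen _ x y at hxy
    induction hxy with
    | rel x y hxy =>
      obtain ⟨a, b, hab, rfl, rfl⟩ := hxy
      exact h hab
    | refl x => exact s.refl x
    | symm x y _ ih => exact s.symm ih
    | trans x y z _ _ ih1 ih2 => exact s.trans ih1 ih2

-- Compatibility of a labelling with a partition becomes an inequality of setoids. Tensor products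
-- and glued diagrams are suprema of pushforwards, so their compatibility splits by `sup_le_iff` and
-- `map_le_iff`.
open Classical in
theorem delta_eq (p : Partn k l) (i : Fin k → Fin N) (j : Fin l → Fin N) :
    p.delta i j = if p ≤ Setoid.ker (Sum.elim i j) then 1 else 0 :=
  if_congr ⟨fun h _ _ => h _ _, fun h _ _ => @h _ _⟩ rfl rfl

theorem delta_tens (p : Partn k l) (q : Partn k' l') (i : Fin (k + k') → Fin N)
    (j : Fin (l + l') → Fin N) :
    (p.tens q).delta i j = p.delta (i ∘ Fin.castAdd k') (j ∘ Fin.castAdd l') *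
      q.delta (i ∘ Fin.natAdd k) (j ∘ Fin.natAdd l) := by
  classical
  have h1 : (Setoid.ker (Sum.elim i j)).comap (Sum.map (Fin.castAdd k') (Fin.castAdd l')) =
      Setoid.ker (Sum.elim (i ∘ Fin.castAdd k') (j ∘ Fin.castAdd l')) := by
    rw [← Sum.elim_comp_map]; rfl
  have h2 : (Setoid.ker (Sum.elim i j)).comap (Sum.map (Fin.natAdd k) (Fin.natAdd l)) =
      Setoid.ker (Sum.elim (i ∘ Fin.natAdd k) (j ∘ Fin.natAdd l)) := by
    rw [← Sum.elim_comp_map]; rfl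
  rw [delta_eq, delta_eq, delta_eq, ite_zero_mul_ite_zero, one_mul]
  simp only [tens, sup_le_iff, map_le_iff, h1, h2]

theorem delta_flip (p : Partn k l) (i : Fin k → Fin N) (j : Fin l → Fin N) :
    p.flip.delta j i = p.delta i j := by
  classical
  rw [delta_eq, delta_eq]
  congr 1
  refine propext ⟨fun h x y hxy => ?_, fun h x y hxy => ?_⟩
  · have := @h x.swap y.swap (by simpa [flip, Setoid.comap_rel] using hxy)
    rcases x with x | x <;> rcases y with y | y <;> exact this
  · have := h hxy
    rcases x with x | x <;> rcases y with y | y <;> exact this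

theorem glue_le_iff (q : Partn l m) (p : Partn k l) (i : Fin k → Fin N) (h : Fin l → Fin N)
    (j : Fin m → Fin N) :
    glue q p ≤ Setoid.ker (Sum.elim i (Sum.elim h j)) ↔
      p ≤ Setoid.ker (Sum.elim i h) ∧ q ≤ Setoid.ker (Sum.elim h j) := by
  have h1 : (Setoid.ker (Sum.elim i (Sum.elim h j))).comap (Sum.map id Sum.inl) =
      Setoid.ker (Sum.elim i h) := by
    change Setoid.ker (Sum.elim i (Sum.elim h j) ∘ Sum.map id Sum.inl) = _
    rw [Sum.elim_comp_map]; rfl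
  rw [glue, sup_le_iff, map_le_iff, map_le_iff, h1]
  rfl

/-- Labellings of the middle row that are compatible with the glued diagram. -/
def middleEquiv (q : Partn l m) (p : Partn k l) (i : Fin k → Fin N) (j : Fin m → Fin N) :
    {h : Fin l → Fin N // glue q p ≤ Setoid.ker (Sum.elim i (Sum.elim h j))} ≃
      {F : Quotient (glue q p) → Fin N // ∀ x, F (Quotient.mk _ (outer k l m x)) =
        Sum.elim i j x} where
  toFun h := ⟨Quotient.lift (Sum.elim i (Sum.elim h.1 j)) (fun _ _ e => h.2 e), by
    rintro (x | x) <;> rfl⟩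
  invFun F := ⟨fun a => F.1 (Quotient.mk _ (Sum.inr (Sum.inl a))), by
    have e : Sum.elim i (Sum.elim (fun a => F.1 (Quotient.mk _ (Sum.inr (Sum.inl a)))) j) =
        F.1 ∘ Quotient.mk _ := by
      funext x
      rcases x with x | x | x
      · exact (F.2 (Sum.inl x)).symm
      · rfl
      · exact (F.2 (Sum.inr x)).symm
    rw [e]
    exact fun x y hxy => congrArg F.1 (Quotient.sound hxy)⟩
  left_inv h := rfl
  right_inv F := by
    ext c
    induction c using Quotient.inductionOn with
    | h x =>
      rcases x with x | x | x
      · exact congrArg Fin.val (F.2 (Sum.inl x)).symm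
      · rfl
      · exact congrArg Fin.val (F.2 (Sum.inr x)).symm

/-- A compatible labelling is a function on the components of the glued diagram. Components meeting
an outer point have their label prescribed, consistently by `hc`; each removed component is free and
contributes a factor `N`. -/
theorem card_middle (q : Partn l m) (p : Partn k l) (i : Fin k → Fin N) (j : Fin m → Fin N)
    (hc : q.compPart p ≤ Setoid.ker (Sum.elim i j)) :
    Nat.card {h : Fin l → Fin N // glue q p ≤ Setoid.ker (Sum.elim i (Sum.elim h j))} =
      N ^ loops q p := by
  classical
  let hit : Quotient (glue q p) → Prop := fun c => ∃ x, Quotient.mk _ (outer k l m x) = c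
  -- The label is read at an arbitrarily chosen outer point of the component; `hc` makes the choice
  -- irrelevant.
  let x₀ : {c // hit c} → Fin N := fun c => Sum.elim i j c.2.choose
  have hx : ∀ x (h : hit (Quotient.mk _ (outer k l m x))), x₀ ⟨_, h⟩ = Sum.elim i j x := fun x h =>
    hc (Quotient.exact h.choose_spec : glue q p (outer k l m h.choose) (outer k l m x))
  have e : {F : Quotient (glue q p) → Fin N // ∀ x, F (Quotient.mk _ (outer k l m x)) =
      Sum.elim i j x} ≃ {F : Quotient (glue q p) → Fin N // F ∘ Subtype.val = x₀} := by
    refine Equiv.subtypeEquivRight fun F => ⟨fun h => ?_, fun h x => ?_⟩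
    · funext ⟨c, x, hxc⟩
      subst hxc
      exact (h x).trans (hx x ⟨x, rfl⟩).symm
    · exact (congrFun h ⟨_, x, rfl⟩).trans (hx x ⟨x, rfl⟩)
  have e' : {c // ¬ hit c} ≃ {c : Quotient (glue q p) // ∀ x, Quotient.mk _ (outer k l m x) ≠ c} :=
    Equiv.subtypeEquivRight fun c => not_exists
  have : Finite (Quotient (glue q p)) := Quotient.finite _
  rw [Nat.card_congr ((middleEquiv q p i j).trans (e.trans (Equiv.subtypePreimage hit x₀))),
    Nat.card_fun, Nat.card_congr e', Nat.card_eq_fintype_card, Fintype.card_fin, loops]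

/-- The left side counts the labellings of the middle row compatible with both diagrams. If the
outer labelling respects the composed partition, this is `card_middle`; otherwise no middle
labelling exists, since one would force the outer labels to agree. -/
theorem sum_delta_mul_delta (q : Partn l m) (p : Partn k l) (i : Fin k → Fin N)
    (j : Fin m → Fin N) :
    ∑ h, q.delta h j * p.delta i h = (N : ℂ) ^ loops q p * (q.compPart p).delta i j := by
  classical
  have e : ∀ h : Fin l → Fin N, q.delta h j * p.delta i h =
      if glue q p ≤ Setoid.ker (Sum.elim i (Sum.elim h j)) then 1 else 0 := fun h => by
    rw [delta_eq, delta_eq, ite_zero_mul_ite_zero, one_mul]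
    simp only [glue_le_iff, and_comm]
  rw [Finset.sum_congr rfl fun h _ => e h, Finset.sum_boole, ← Fintype.card_subtype,
    ← Nat.card_eq_fintype_card, delta_eq]
  split_ifs with hc
  · rw [card_middle q p i j hc, mul_one, Nat.cast_pow]
  · rw [mul_zero, Nat.cast_eq_zero, Nat.card_eq_zero]
    refine Or.inl ⟨fun ⟨h, hh⟩ => hc fun x y hxy => ?_⟩
    have := hh hxy
    rcases x with x | x <;> rcases y with y | y <;> exact this

theorem delta_const (p : Partn k l) (a : Fin N) : p.delta (fun _ => a) (fun _ => a) = 1 := by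
  classical
  rw [delta_eq, if_pos]
  intro x y _
  rcases x with x | x <;> rcases y with y | y <;> rfl

/-- With as many labels as points, the blocks of `q` can be given distinct labels. The kernel of
this labelling is exactly `q`, so `δ_q = 1`, and `δ_p = 1` says `p ≤ q`. -/
theorem le_of_delta (p q : Partn k l)
    (h : ∀ (i : Fin k → Fin (k + l)) (j : Fin l → Fin (k + l)), p.delta i j = q.delta i j) :
    p ≤ q := by
  classical
  -- Each block is labelled by the position of a chosen representative.
  let f : Quotient q → Fin (k + l) := fun c => finSumFinEquiv (Quotient.out c)
  have hf : Function.Injective f := fun c d hcd => by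
    rw [← Quotient.out_eq c, ← Quotient.out_eq d, finSumFinEquiv.injective hcd]
  let g : Fin k ⊕ Fin l → Fin (k + l) := fun x => f (Quotient.mk _ x)
  have hg : Setoid.ker g = q := by
    ext x y
    exact ⟨fun e => Quotient.exact (hf e), fun e => congrArg f (Quotient.sound e)⟩
  have := h (g ∘ Sum.inl) (g ∘ Sum.inr)
  rw [delta_eq, delta_eq, Sum.elim_comp_inl_inr, hg, if_pos le_rfl] at this
  by_contra hc
  rw [if_neg hc] at this
  exact zero_ne_one this

theorem eq_of_delta (p q : Partn k l)
    (h : ∀ (i : Fin k → Fin (k + l)) (j : Fin l → Fin (k + l)), p.delta i j = q.delta i j) :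
    p = q :=
  le_antisymm (le_of_delta p q h) (le_of_delta q p fun i j => (h i j).symm)

end Partn

/-! ### The functor `T`, and recovering partitions from matrices for all `N` -/

namespace PLin

variable {k l m k' l' m' : ℕ} {N : ℕ}

theorem induction_of {P : PLin k l → Prop} (p : PLin k l) (h0 : P 0)
    (ha : ∀ p q, P p → P q → P (p + q)) (hs : ∀ (c : ℂ) x, P (of x) → P (c • of x))
    (ho : ∀ x, P (of x)) : P p := by
  induction p using Finsupp.induction_linear with
  | zero => exact h0
  | add p q hp hq => exact ha p q hp hq
  | single x c =>
    have : Finsupp.single x c = c • of x := by rw [of, Finsupp.smul_single, smul_eq_mul, mul_one]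
    rw [this]
    exact hs c x (ho x)

theorem tens_of (p : Partn k l) (q : Partn k' l') : tens (of p) (of q) = of (p.tens q) := by
  simp [tens, of]

theorem comp_of (q : Partn l m) (p : Partn k l) :
    comp N (of q) (of p) = (N : ℂ) ^ q.loops p • of (q.compPart p) := by
  simp [comp, of]

theorem adj_of (p : Partn k l) : adj (of p) = of p.flip := by
  simp [adj, of]

theorem adj_zero : adj (0 : PLin k l) = 0 := by
  simp [adj]

theorem adj_add (p q : PLin k l) : adj (p + q) = adj p + adj q := by
  rw [adj, Finsupp.mapRange_add (fun _ _ => map_add _ _ _), Finsupp.mapDomain_add]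
  rfl

theorem adj_smul (c : ℂ) (p : PLin k l) : adj (c • p) = star c • adj p := by
  rw [adj, Finsupp.mapRange_smul' c (star c) p (fun x => by simp), Finsupp.mapDomain_smul]
  rfl

theorem T_of (p : Partn k l) (j : Fin l → Fin N) (i : Fin k → Fin N) :
    T N (of p) j i = p.delta i j := by
  simp [T, of]

theorem T_comp (q : PLin l m) (p : PLin k l) : T N (comp N q p) = T N q * T N p := by
  induction q using induction_of with
  | h0 => simp
  | ha q q' h h' => rw [map_add, LinearMap.add_apply, map_add, h, h', map_add, Matrix.add_mul]
  | hs c x h => rw [map_smul, LinearMap.smul_apply, map_smul, h, map_smul, Matrix.smul_mul]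
  | ho q =>
    induction p using induction_of with
    | h0 => simp
    | ha q q' h h' => rw [map_add, map_add, h, h', map_add, Matrix.mul_add]
    | hs c x h => rw [map_smul, map_smul, h, map_smul, Matrix.mul_smul]
    | ho p =>
      ext j i
      rw [comp_of, map_smul, Matrix.smul_apply, T_of, Matrix.mul_apply, smul_eq_mul,
        ← Partn.sum_delta_mul_delta]
      simp only [T_of]

/-- The tensor product of matrices indexed by multi-indices. -/
def matTens {R : Type*} [Mul R] (A : Matrix (Fin l → Fin N) (Fin k → Fin N) R)
    (B : Matrix (Fin l' → Fin N) (Fin k' → Fin N) R) :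
    Matrix (Fin (l + l') → Fin N) (Fin (k + k') → Fin N) R :=
  Matrix.of fun j i => A (j ∘ Fin.castAdd l') (i ∘ Fin.castAdd k') *
    B (j ∘ Fin.natAdd l) (i ∘ Fin.natAdd k)

theorem matTens_mul {R : Type*} [CommSemiring R] (A : Matrix (Fin m → Fin N) (Fin l → Fin N) R)
    (B : Matrix (Fin m' → Fin N) (Fin l' → Fin N) R)
    (C : Matrix (Fin l → Fin N) (Fin k → Fin N) R)
    (D : Matrix (Fin l' → Fin N) (Fin k' → Fin N) R) :
    matTens A B * matTens C D = matTens (A * C) (B * D) := by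
  ext j i
  simp only [matTens, Matrix.mul_apply, Matrix.of_apply]
  rw [← (Fin.appendEquiv l l').sum_comp, Fintype.sum_prod_type, Finset.sum_mul_sum]
  refine Finset.sum_congr rfl fun a _ => Finset.sum_congr rfl fun b _ => ?_
  have h1 : Fin.appendEquiv l l' (a, b) ∘ Fin.castAdd l' = a :=
    funext fun x => Fin.append_left a b x
  have h2 : Fin.appendEquiv l l' (a, b) ∘ Fin.natAdd l = b :=
    funext fun x => Fin.append_right a b x
  rw [h1, h2]
  ring

theorem matTens_conjTranspose (A : Matrix (Fin l → Fin N) (Fin k → Fin N) ℂ)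
    (B : Matrix (Fin l' → Fin N) (Fin k' → Fin N) ℂ) :
    (matTens A B).conjTranspose = matTens A.conjTranspose B.conjTranspose := by
  ext j i
  simp [matTens, Matrix.conjTranspose_apply]

theorem T_tens (p : PLin k l) (q : PLin k' l') : T N (tens p q) = matTens (T N p) (T N q) := by
  induction p using induction_of with
  | h0 => ext; simp [matTens]
  | ha q q' h h' =>
    rw [map_add, LinearMap.add_apply, map_add, h, h', map_add]
    ext
    simp [matTens, add_mul]
  | hs c x h =>
    rw [map_smul, LinearMap.smul_apply, map_smul, h, map_smul]
    ext
    simp [matTens, mul_assoc]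
  | ho p =>
    induction q using induction_of with
    | h0 => ext; simp [matTens]
    | ha q q' h h' =>
      rw [map_add, map_add, h, h', map_add]
      ext
      simp [matTens, mul_add]
    | hs c x h =>
      rw [map_smul, map_smul, h, map_smul]
      ext
      simp [matTens, mul_left_comm]
    | ho q =>
      ext j i
      rw [tens_of, T_of, Partn.delta_tens]
      simp only [matTens, Matrix.of_apply, T_of]

theorem T_adj (p : PLin k l) : T N (adj p) = (T N p).conjTranspose := by
  induction p using induction_of with
  | h0 => simp [adj_zero]
  | ha p q hp hq => rw [adj_add, map_add, hp, hq, map_add, Matrix.conjTranspose_add]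
  | hs c x h => rw [adj_smul, map_smul, h, map_smul, Matrix.conjTranspose_smul]
  | ho p =>
    ext j i
    rw [adj_of, T_of, Matrix.conjTranspose_apply, T_of, Partn.delta_flip, Partn.delta]
    split_ifs <;> simp

/-- A family of elements `f N`, one for each value `N` of the loop parameter, that is a power of
the loop parameter times a fixed partition. -/
def IsMonomial (f : ℕ → PLin k l) : Prop :=
  ∃ (a : ℕ) (x : Partn k l), ∀ N, f N = (N : ℂ) ^ a • of x

namespace IsMonomial

theorem const (x : Partn k l) : IsMonomial fun _ => of x := ⟨0, x, fun N => by simp⟩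

theorem pow_smul {f : ℕ → PLin k l} (hf : IsMonomial f) (b : ℕ) :
    IsMonomial fun N => (N : ℂ) ^ b • f N := by
  obtain ⟨a, x, h⟩ := hf
  exact ⟨b + a, x, fun N => by beta_reduce; rw [h, smul_smul, pow_add]⟩

theorem comp {f : ℕ → PLin l m} {g : ℕ → PLin k l} (hf : IsMonomial f) (hg : IsMonomial g) :
    IsMonomial fun N => PLin.comp N (f N) (g N) := by
  obtain ⟨a, x, h⟩ := hf
  obtain ⟨b, y, h'⟩ := hg
  refine ⟨a + b + x.loops y, x.compPart y, fun N => ?_⟩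
  beta_reduce
  rw [h, h', map_smul, map_smul, LinearMap.smul_apply, comp_of, smul_smul, smul_smul, pow_add,
    pow_add, mul_comm ((N : ℂ) ^ b)]

theorem tens {f : ℕ → PLin k l} {g : ℕ → PLin k' l'} (hf : IsMonomial f) (hg : IsMonomial g) :
    IsMonomial fun N => PLin.tens (f N) (g N) := by
  obtain ⟨a, x, h⟩ := hf
  obtain ⟨b, y, h'⟩ := hg
  refine ⟨a + b, x.tens y, fun N => ?_⟩
  beta_reduce
  rw [h, h', map_smul, map_smul, LinearMap.smul_apply, tens_of, smul_smul, pow_add, mul_comm]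

theorem adj {f : ℕ → PLin k l} (hf : IsMonomial f) : IsMonomial fun N => PLin.adj (f N) := by
  obtain ⟨a, x, h⟩ := hf
  exact ⟨a, x.flip, fun N => by beta_reduce; rw [h, adj_smul, adj_of, star_pow, star_natCast]⟩

/-- Monomial families are determined by the associated matrices. -/
theorem ext {f g : ℕ → PLin k l} (hf : IsMonomial f) (hg : IsMonomial g)
    (h : ∀ N, T N (f N) = T N (g N)) (N : ℕ) : f N = g N := by
  obtain ⟨a, x, hx⟩ := hf
  obtain ⟨b, y, hy⟩ := hg
  have key : ∀ (N : ℕ) (j : Fin l → Fin N) (i : Fin k → Fin N),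
      (N : ℂ) ^ a * x.delta i j = (N : ℂ) ^ b * y.delta i j := fun N j i => by
    have := congrFun (congrFun (h N) j) i
    rwa [hx, hy, map_smul, map_smul, Matrix.smul_apply, Matrix.smul_apply, T_of, T_of] at this
  -- Constant labellings are compatible with every partition, so at `N = 2` they give `2 ^ a = 2 ^
  -- b`.
  have hab : a = b := by
    have := key 2 (fun _ => 0) (fun _ => 0)
    rw [Partn.delta_const, Partn.delta_const, mul_one, mul_one] at this
    exact Nat.pow_right_injective le_rfl (by exact_mod_cast this)
  subst hab
  -- With no points there is only one partition. Otherwise `N = k + l` is nonzero, so the common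
  -- power cancels, and it provides enough labels to separate partitions.
  have hxy : x = y := by
    rcases Nat.eq_zero_or_pos (k + l) with h0 | h0
    · have : IsEmpty (Fin k ⊕ Fin l) := by
        rw [isEmpty_sum, ← not_nonempty_iff, ← not_nonempty_iff, ← Fin.pos_iff_nonempty,
          ← Fin.pos_iff_nonempty]
        omega
      exact Setoid.ext fun a => isEmptyElim a
    · refine Partn.eq_of_delta x y fun i j => ?_
      refine mul_left_cancel₀ ?_ (key (k + l) j i)
      exact pow_ne_zero _ (Nat.cast_ne_zero.2 h0.ne')
  rw [hx, hy, hxy]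

end IsMonomial

end PLin

/-! ### Rules of the diagram calculus -/

namespace PLin

variable {k l m n k' l' m' : ℕ} {N : ℕ}

/-- Multilinearity reduces to single partitions, where both sides are monomial in the loop parameter
and have the same matrix for every `N`, by associativity of matrix multiplication. The other rules
follow the same pattern. -/
theorem comp_assoc (r : PLin m n) (q : PLin l m) (p : PLin k l) :
    comp N r (comp N q p) = comp N (comp N r q) p := by
  induction r using induction_of with
  | h0 => simp
  | ha a b ha hb => simp only [map_add, LinearMap.add_apply, ha, hb]
  | hs c x h => simp only [map_smul, LinearMap.smul_apply, h]
  | ho r =>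
    induction q using induction_of with
    | h0 => simp
    | ha a b ha hb => simp only [map_add, LinearMap.add_apply, ha, hb]
    | hs c x h => simp only [map_smul, LinearMap.smul_apply, h]
    | ho q =>
      induction p using induction_of with
      | h0 => simp
      | ha a b ha hb => simp only [map_add, ha, hb]
      | hs c x h => simp only [map_smul, h]
      | ho p =>
        have c := @IsMonomial.const
        exact IsMonomial.ext ((c r).comp ((c q).comp (c p))) (((c r).comp (c q)).comp (c p))
          (fun N => by simp only [T_comp, Matrix.mul_assoc]) N

theorem comp_tens (q : PLin l m) (q' : PLin l' m') (p : PLin k l) (p' : PLin k' l') :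
    comp N (tens q q') (tens p p') = tens (comp N q p) (comp N q' p') := by
  induction q using induction_of with
  | h0 => simp
  | ha a b ha hb => simp only [map_add, LinearMap.add_apply, ha, hb]
  | hs c x h => simp only [map_smul, LinearMap.smul_apply, h]
  | ho q =>
    induction q' using induction_of with
    | h0 => simp
    | ha a b ha hb => simp only [map_add, LinearMap.add_apply, ha, hb]
    | hs c x h => simp only [map_smul, LinearMap.smul_apply, h]
    | ho q' =>
      induction p using induction_of with
      | h0 => simp
      | ha a b ha hb => simp only [map_add, LinearMap.add_apply, ha, hb]
      | hs c x h => simp only [map_smul, LinearMap.smul_apply, h]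
      | ho p =>
        induction p' using induction_of with
        | h0 => simp
        | ha a b ha hb => simp only [map_add, ha, hb]
        | hs c x h => simp only [map_smul, h]
        | ho p' =>
          have c := @IsMonomial.const
          exact IsMonomial.ext (((c q).tens (c q')).comp ((c p).tens (c p')))
            (((c q).comp (c p)).tens ((c q').comp (c p')))
            (fun N => by simp only [T_comp, T_tens, matTens_mul]) N

theorem adj_comp (q : PLin l m) (p : PLin k l) :
    adj (comp N q p) = comp N (adj p) (adj q) := by
  induction q using induction_of with
  | h0 => simp [adj_zero]
  | ha a b ha hb => simp only [map_add, LinearMap.add_apply, adj_add, ha, hb]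
  | hs c x h => simp only [map_smul, LinearMap.smul_apply, adj_smul, h]
  | ho q =>
    induction p using induction_of with
    | h0 => simp [adj_zero]
    | ha a b ha hb => simp only [map_add, LinearMap.add_apply, adj_add, ha, hb]
    | hs c x h => simp only [map_smul, LinearMap.smul_apply, adj_smul, h]
    | ho p =>
      have c := @IsMonomial.const
      exact IsMonomial.ext ((c q).comp (c p)).adj ((c p).adj.comp (c q).adj)
        (fun N => by simp only [T_comp, T_adj, Matrix.conjTranspose_mul]) N

theorem adj_tens (p : PLin k l) (q : PLin k' l') :
    adj (tens p q) = tens (adj p) (adj q) := by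
  induction p using induction_of with
  | h0 => simp [adj_zero]
  | ha a b ha hb => simp only [map_add, LinearMap.add_apply, adj_add, ha, hb]
  | hs c x h => simp only [map_smul, LinearMap.smul_apply, adj_smul, h]
  | ho p =>
    induction q using induction_of with
    | h0 => simp [adj_zero]
    | ha a b ha hb => simp only [map_add, adj_add, ha, hb]
    | hs c x h => simp only [map_smul, adj_smul, h]
    | ho q =>
      have c := @IsMonomial.const
      -- Neither side involves the loop parameter, so the value `0` at which the equality is finally
      -- read is arbitrary.
      exact IsMonomial.ext ((c p).tens (c q)).adj ((c p).adj.tens (c q).adj)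
        (fun N => by simp only [T_tens, T_adj, matTens_conjTranspose]) 0

theorem adj_adj (p : PLin k l) : adj (adj p) = p := by
  induction p using induction_of with
  | h0 => simp [adj_zero]
  | ha a b ha hb => rw [adj_add, adj_add, ha, hb]
  | hs c x h => rw [adj_smul, adj_smul, star_star, h]
  | ho p =>
    exact IsMonomial.ext (IsMonomial.const p).adj.adj (IsMonomial.const p)
      (fun N => by simp only [T_adj, Matrix.conjTranspose_conjTranspose]) 0

/-- The last factor has one point in each row so that `k + k' + 1` and `k + (k' + 1)` agree
definitionally and no cast is needed. This is all that tensor powers require. -/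
theorem tens_assoc_one (p : PLin k l) (q : PLin k' l') (r : PLin 1 1) :
    tens (tens p q) r = (tens p (tens q r) : PLin (k + (k' + 1)) (l + (l' + 1))) := by
  induction p using induction_of with
  | h0 => simp
  | ha a b ha hb =>
    rw [map_add, LinearMap.add_apply, map_add, LinearMap.add_apply, ha, hb, map_add]; rfl
  | hs c x h => simp only [map_smul, LinearMap.smul_apply, h]
  | ho p =>
    induction q using induction_of with
    | h0 => simp
    | ha a b ha hb => simp only [map_add, LinearMap.add_apply, ha, hb]
    | hs c x h => simp only [map_smul, LinearMap.smul_apply, h]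
    | ho q =>
      induction r using induction_of with
      | h0 => simp
      | ha a b ha hb => simp only [map_add, ha, hb]
      | hs c x h => simp only [map_smul, h]
      | ho r =>
        have c := @IsMonomial.const
        refine IsMonomial.ext (((c p).tens (c q)).tens (c r)) ((c p).tens ((c q).tens (c r)))
          (fun N => ?_) 0
        have h1 := T_tens (N := N) (tens (of p) (of q)) (of r)
        have h2 := T_tens (N := N) (of p) (tens (of q) (of r))
        rw [T_tens (of p) (of q)] at h1
        rw [T_tens (of q) (of r)] at h2
        refine h1.trans (Eq.trans ?_ h2.symm)
        ext j i
        simp only [matTens, Matrix.of_apply]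
        have e : ∀ {a b : ℕ} (f : Fin (a + b + 1) → Fin N), f ∘ Fin.natAdd (a + b) =
            ((f ∘ Fin.natAdd a : Fin (b + 1) → Fin N) ∘ Fin.natAdd b : Fin 1 → Fin N) :=
          fun f => funext fun x => congrArg f (Fin.ext (Nat.add_assoc _ _ _))
        rw [mul_assoc, e, e]
        rfl

theorem tens_empty (p : PLin k l) : tens p (of (⊤ : Partn 0 0)) = p := by
  induction p using induction_of with
  | h0 => simp
  | ha a b ha hb => rw [map_add, LinearMap.add_apply, ha, hb]
  | hs c x h => rw [map_smul, LinearMap.smul_apply, h]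
  | ho p =>
    have c := @IsMonomial.const
    refine @IsMonomial.ext k l (fun _ => tens (of p) (of (⊤ : Partn 0 0))) (fun _ => of p)
      ((c p).tens (c ⊤)) (c p) (fun N => ?_) 0
    refine (T_tens (of _) (of _)).trans ?_
    ext j i
    simp only [matTens, Matrix.of_apply, T_of]
    have : (⊤ : Partn 0 0).delta (i ∘ Fin.natAdd k) (j ∘ Fin.natAdd l) = 1 := by
      rw [Partn.delta, if_pos]
      intro x
      exact isEmptyElim x
    rw [this, mul_one]
    rfl

theorem empty_tens (p : PLin 1 1) : tens (of (⊤ : Partn 0 0)) p = p := by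
  induction p using induction_of with
  | h0 => simp
  | ha a b ha hb => rw [map_add, ha, hb]
  | hs c x h => rw [map_smul, h]
  | ho p =>
    have c := @IsMonomial.const
    refine @IsMonomial.ext 1 1 (fun _ => tens (of (⊤ : Partn 0 0)) (of p)) (fun _ => of p)
      ((c ⊤).tens (c p)) (c p) (fun N => ?_) 0
    refine (T_tens (of _) (of _)).trans ?_
    ext j i
    simp only [matTens, Matrix.of_apply, T_of]
    have : (⊤ : Partn 0 0).delta (i ∘ Fin.castAdd 1) (j ∘ Fin.castAdd 1) = 1 := by
      rw [Partn.delta, if_pos]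
      intro x
      exact isEmptyElim x
    have e : Fin.natAdd 0 = (id : Fin 1 → Fin 1) := by
      funext x
      exact Subsingleton.elim (α := Fin 1) _ _
    rw [this, one_mul]
    change p.delta (i ∘ Fin.natAdd 0) (j ∘ Fin.natAdd 0) = _
    rw [e]
    rfl

theorem T_empty : T N (of (⊤ : Partn 0 0)) = 1 := by
  ext j i
  rw [T_of, Subsingleton.elim i j, Matrix.one_apply_eq, Partn.delta, if_pos]
  intro x
  exact isEmptyElim x

theorem tensPow_one (p : PLin 1 1) : tensPow p 1 = p := empty_tens p

/-- Tensor powers are built by adding factors on the right; splitting them at any place is what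
makes conjugation by them multiplicative for tensor products. -/
theorem tensPow_add (p : PLin 1 1) (a b : ℕ) :
    tensPow p (a + b) = tens (tensPow p a) (tensPow p b) := by
  induction b with
  | zero => exact (tens_empty _).symm
  | succ b ih =>
    change tens (tensPow p (a + b)) p = tens (tensPow p a) (tens (tensPow p b) p)
    rw [ih, tens_assoc_one]

theorem comp_tensPow (p q : PLin 1 1) (n : ℕ) :
    comp N (tensPow p n) (tensPow q n) = tensPow (comp N p q) n := by
  induction n with
  | zero =>
    have c := @IsMonomial.const
    exact IsMonomial.ext ((c ⊤).comp (c ⊤)) (c ⊤)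
      (fun N => by rw [T_comp, T_empty, Matrix.one_mul]) N
  | succ n ih =>
    change comp N (tens (tensPow p n) p) (tens (tensPow q n) q) = tens _ _
    rw [comp_tens, ih]

theorem adj_tensPow (p : PLin 1 1) (n : ℕ) : adj (tensPow p n) = tensPow (adj p) n := by
  induction n with
  | zero =>
    have c := @IsMonomial.const
    exact IsMonomial.ext (c ⊤).adj (c ⊤)
      (fun N => by rw [T_adj, T_empty, Matrix.conjTranspose_one]) 0
  | succ n ih =>
    change adj (tens (tensPow p n) p) = tens _ _
    rw [adj_tens, ih]

theorem T_tensPow (p : PLin 1 1) (n : ℕ) (j i : Fin n → Fin N) :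
    T N (tensPow p n) j i = ∏ r, T N p (fun _ => j r) (fun _ => i r) := by
  induction n with
  | zero =>
    change T N (of ⊤) j i = _
    rw [T_empty, Subsingleton.elim i j, Matrix.one_apply_eq, Fin.prod_univ_zero]
  | succ n ih =>
    change T N (tens (tensPow p n) p) j i = _
    rw [T_tens, Fin.prod_univ_castSucc]
    simp only [matTens, Matrix.of_apply, ih]
    have e : ∀ f : Fin (n + 1) → Fin N, f ∘ Fin.natAdd n = fun _ : Fin 1 => f (Fin.last n) :=
      fun f => funext fun x => by rw [Subsingleton.elim x 0]; rfl
    rw [e, e]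
    rfl

open Classical in
theorem T_idPart (j i : Fin 1 → Fin N) : T N idPart j i = if j 0 = i 0 then 1 else 0 := by
  rw [idPart, T_of, Partn.delta]
  refine if_congr ⟨fun h => h (Sum.inr 0) (Sum.inl 0) trivial, fun h x y _ => ?_⟩ rfl rfl
  rcases x with x | x <;> rcases y with y | y <;> rw [Subsingleton.elim x 0, Subsingleton.elim y 0]
  · exact h.symm
  · exact h

theorem T_disc (j i : Fin 1 → Fin N) : T N disc j i = 1 := by
  rw [disc, T_of, Partn.delta, if_pos]
  rintro x y rfl
  rfl

theorem T_doubleSingleton (j : Fin 2 → Fin N) (i : Fin 0 → Fin N) :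
    T N doubleSingleton j i = 1 := by
  rw [doubleSingleton, T_of, Partn.delta, if_pos]
  rintro x y rfl
  rfl

open Classical in
theorem T_pairPart (j : Fin 2 → Fin N) (i : Fin 0 → Fin N) :
    T N pairPart j i = if j 0 = j 1 then 1 else 0 := by
  rw [pairPart, T_of, Partn.delta]
  refine if_congr ⟨fun h => h (Sum.inr 0) (Sum.inr 1) trivial, fun h x y _ => ?_⟩ rfl rfl
  rcases x with x | x
  · exact x.elim0
  rcases y with y | y
  · exact y.elim0
  fin_cases x <;> fin_cases y
  · rfl
  · exact h
  · exact h.symm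
  · rfl

theorem T_tensPow_idPart (n : ℕ) : T N (tensPow idPart n) = 1 := by
  classical
  ext j i
  rw [T_tensPow]
  simp only [T_idPart]
  rw [Finset.prod_boole, Matrix.one_apply]
  simp only [Finset.mem_univ, true_imp_iff, funext_iff]

/-- Comparing monomial families needs the identity on `n` points to be a single partition; which one
is irrelevant, as its matrix is known. -/
theorem exists_tensPow_idPart (n : ℕ) : ∃ x : Partn n n, tensPow idPart n = of x := by
  induction n with
  | zero => exact ⟨⊤, rfl⟩
  | succ n ih =>
    obtain ⟨x, hx⟩ := ih
    refine ⟨x.tens (⊤ : Partn 1 1), ?_⟩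
    change tens _ (of ⊤) = _
    rw [hx, tens_of]

theorem id_comp (p : PLin k l) : comp N (tensPow idPart l) p = p := by
  induction p using induction_of with
  | h0 => simp
  | ha a b ha hb => rw [map_add, ha, hb]
  | hs c x h => rw [map_smul, h]
  | ho p =>
    have c := @IsMonomial.const
    obtain ⟨x, hx⟩ := exists_tensPow_idPart l
    rw [hx]
    exact IsMonomial.ext ((c x).comp (c p)) (c p)
      (fun N => by rw [T_comp, ← hx, T_tensPow_idPart, Matrix.one_mul]) N

theorem adj_idPart : adj idPart = idPart := by
  classical
  have c := @IsMonomial.const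
  refine IsMonomial.ext (c ⊤).adj (c ⊤) (fun N => ?_) 0
  rw [T_adj]
  ext j i
  change star (T N idPart i j) = T N idPart j i
  rw [T_idPart, T_idPart]
  split_ifs with h1 h2 h2 <;> simp_all

/-- The adjoint of the left unit law. -/
theorem comp_id (p : PLin k l) : comp N p (tensPow idPart k) = p := by
  have h := id_comp (N := N) (adj p)
  rw [← adj_adj (comp N p _), adj_comp, adj_tensPow]
  rw [adj_idPart, h, adj_adj]

end PLin

/-! ### The involution `τ` and conjugation by its tensor powers -/

namespace PLin

variable {k l m n k' l' m' : ℕ} {N : ℕ}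

theorem sum_fin_one {M : Type*} [AddCommMonoid M] (f : (Fin 1 → Fin N) → M) :
    ∑ h, f h = ∑ a, f fun _ => a :=
  ((Equiv.funUnique (Fin 1) (Fin N)).symm.sum_comp f).symm

theorem adj_disc : adj disc = disc := by
  have c := @IsMonomial.const
  refine IsMonomial.ext (c ⊥).adj (c ⊥) (fun N => ?_) 0
  rw [T_adj]
  ext j i
  change star (T N disc i j) = T N disc j i
  rw [T_disc, T_disc, star_one]

/-- The two middle singletons are glued to one removed component; in matrices, `J² = N J`. -/
theorem comp_disc_disc : comp N disc disc = (N : ℂ) • disc := by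
  have c := @IsMonomial.const
  have h := IsMonomial.ext ((c (⊥ : Partn 1 1)).comp (c (⊥ : Partn 1 1)))
    ((c (⊥ : Partn 1 1)).pow_smul 1) (fun N => ?_) N
  · rwa [pow_one] at h
  · rw [T_comp, pow_one, map_smul]
    ext j i
    change (T N disc * T N disc) j i = (N : ℂ) • T N disc j i
    rw [Matrix.mul_apply, sum_fin_one]
    simp [T_disc]

theorem idPart_comp (p : PLin k 1) : comp N idPart p = p := by
  have := id_comp (N := N) p
  rwa [tensPow_one] at this

theorem comp_idPart (p : PLin 1 l) : comp N p idPart = p := by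
  have := comp_id (N := N) p
  rwa [tensPow_one] at this

/-- The coefficient of `disc` is `-4/N + (4/N²) N = 0`. In matrices, `T_τ` is the reflection that
negates the vector `(1, …, 1)`. -/
theorem comp_tau_tau (hN : 0 < N) : comp N (tau N) (tau N) = idPart := by
  have hN' : (N : ℂ) ≠ 0 := Nat.cast_ne_zero.2 hN.ne'
  simp only [tau, map_sub, map_smul, LinearMap.sub_apply, LinearMap.smul_apply, comp_idPart,
    idPart_comp, comp_disc_disc, smul_smul]
  have : 2 / (N : ℂ) * N = 2 := div_mul_cancel₀ _ hN'
  rw [this]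
  module

theorem adj_tau : adj (tau N) = tau N := by
  rw [tau, sub_eq_add_neg, ← neg_smul, adj_add, adj_smul, adj_idPart, adj_disc]
  congr 2
  simp

theorem comp_tensPow_tau (hN : 0 < N) (n : ℕ) :
    comp N (tensPow (tau N) n) (tensPow (tau N) n) = tensPow idPart n := by
  rw [comp_tensPow, comp_tau_tau hN]

theorem conjTau_apply (p : PLin k l) :
    conjTau N k l p = comp N (tensPow (tau N) l) (comp N p (tensPow (tau N) k)) := rfl

theorem conjTau_conjTau (hN : 0 < N) (p : PLin k l) :
    conjTau N k l (conjTau N k l p) = p := by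
  rw [conjTau_apply, conjTau_apply, ← comp_assoc, ← comp_assoc, comp_tensPow_tau hN, comp_id,
    comp_assoc, comp_tensPow_tau hN, id_comp]

theorem conjTau_id (hN : 0 < N) (n : ℕ) :
    conjTau N n n (tensPow idPart n) = tensPow idPart n := by
  rw [conjTau_apply, id_comp, comp_tensPow_tau hN]

/-- The two copies of `τ^{⊗l}` that meet between `q` and `p` cancel. -/
theorem conjTau_comp (hN : 0 < N) (q : PLin l m) (p : PLin k l) :
    conjTau N k m (comp N q p) = comp N (conjTau N l m q) (conjTau N k l p) := by
  simp only [conjTau_apply]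
  rw [← comp_assoc, ← comp_assoc, ← comp_assoc q (tensPow (tau N) l),
    comp_assoc (tensPow (tau N) l) (tensPow (tau N) l), comp_tensPow_tau hN, id_comp]

theorem conjTau_tens (p : PLin k l) (q : PLin k' l') :
    conjTau N (k + k') (l + l') (tens p q) = tens (conjTau N k l p) (conjTau N k' l' q) := by
  simp only [conjTau_apply]
  rw [tensPow_add, tensPow_add, comp_tens, comp_tens]

theorem conjTau_adj (p : PLin k l) : conjTau N l k p.adj = (conjTau N k l p).adj := by
  simp only [conjTau_apply]
  rw [adj_comp, adj_comp, adj_tensPow, adj_tensPow, adj_tau, comp_assoc]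

/-- Seen as an `N × N` matrix in the two lower indices, the result is `T_p T_qᵗ`, because the pair
partition only contributes equal labels. -/
theorem T_tens_comp_pairPart (p q : PLin 1 1) (j : Fin 2 → Fin N) (i : Fin 0 → Fin N) :
    T N (comp N (tens p q) pairPart) j i =
      ∑ a, T N p (fun _ => j 0) (fun _ => a) * T N q (fun _ => j 1) (fun _ => a) := by
  classical
  rw [T_comp, T_tens, Matrix.mul_apply, ← (Fin.appendEquiv 1 1).sum_comp, Fintype.sum_prod_type,
    sum_fin_one]
  refine Finset.sum_congr rfl fun a _ => ?_
  rw [sum_fin_one, Finset.sum_eq_single a]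
  · have h0 : (Fin.appendEquiv 1 1 ((fun _ => a : Fin 1 → Fin N), (fun _ => a : Fin 1 → Fin N))) =
        fun _ => a := by
      funext x
      fin_cases x <;> rfl
    rw [h0]
    refine (congrArg _ (T_pairPart (N := N) (fun _ => a) i)).trans ?_
    rw [if_pos rfl, mul_one]
    simp only [matTens, Matrix.of_apply]
    have e0 : j ∘ Fin.castAdd 1 = fun _ : Fin 1 => j 0 :=
      funext fun x => by rw [Subsingleton.elim x 0]; rfl
    have e1 : j ∘ Fin.natAdd 1 = fun _ : Fin 1 => j 1 :=
      funext fun x => by rw [Subsingleton.elim x 0]; rfl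
    rw [e0, e1]
    rfl
  · intro b _ hb
    refine (congrArg _ (T_pairPart (N := N) _ i)).trans ?_
    rw [if_neg, mul_zero]
    exact fun h => hb h.symm
  · exact fun h => absurd (Finset.mem_univ a) h

theorem idPart_tens_idPart_comp : comp N (tens idPart idPart) pairPart = pairPart := by
  classical
  have c := @IsMonomial.const
  refine @IsMonomial.ext 0 2 (fun N => comp N (tens idPart idPart) pairPart)
    (fun _ => pairPart) (((c ⊤).tens (c ⊤)).comp (c ⊤)) (c ⊤) (fun N => ?_) N
  ext j i
  refine (T_tens_comp_pairPart idPart idPart j i).trans ?_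
  refine Eq.trans ?_ (T_pairPart j i).symm
  simp only [T_idPart, mul_boole]
  simp [eq_comm]

theorem idPart_tens_disc_comp : comp N (tens idPart disc) pairPart = doubleSingleton := by
  classical
  have c := @IsMonomial.const
  refine @IsMonomial.ext 0 2 (fun N => comp N (tens idPart disc) pairPart)
    (fun _ => doubleSingleton) (((c ⊤).tens (c ⊥)).comp (c ⊤)) (c ⊥) (fun N => ?_) N
  ext j i
  refine (T_tens_comp_pairPart idPart disc j i).trans ?_
  refine Eq.trans ?_ (T_doubleSingleton j i).symm
  simp [T_idPart, T_disc]

theorem disc_tens_idPart_comp : comp N (tens disc idPart) pairPart = doubleSingleton := by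
  classical
  have c := @IsMonomial.const
  refine @IsMonomial.ext 0 2 (fun N => comp N (tens disc idPart) pairPart)
    (fun _ => doubleSingleton) (((c ⊥).tens (c ⊤)).comp (c ⊤)) (c ⊥) (fun N => ?_) N
  ext j i
  refine (T_tens_comp_pairPart disc idPart j i).trans ?_
  refine Eq.trans ?_ (T_doubleSingleton j i).symm
  simp [T_idPart, T_disc]

theorem disc_tens_disc_comp :
    comp N (tens disc disc) pairPart = (N : ℂ) • doubleSingleton := by
  have c := @IsMonomial.const
  have h := @IsMonomial.ext 0 2 (fun N => comp N (tens disc disc) pairPart)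
    (fun N => (N : ℂ) ^ 1 • doubleSingleton) (((c ⊥).tens (c ⊥)).comp (c ⊤))
    ((c ⊥).pow_smul 1) (fun N => ?_) N
  · simpa only [pow_one] using h
  · ext j i
    refine (T_tens_comp_pairPart disc disc j i).trans ?_
    rw [pow_one, map_smul, Matrix.smul_apply]
    refine Eq.trans ?_ (congrArg _ (T_doubleSingleton j i).symm)
    simp [T_disc]

/-- This is `T_τ T_τᵗ = 1` in diagrams: on expanding `τ ⊗ τ`, the double singleton receives the
coefficient `-2/N - 2/N + (4/N²) N = 0`. -/
theorem conjTau_pairPart (hN : 0 < N) : conjTau N 0 2 pairPart = pairPart := by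
  have hN' : (N : ℂ) ≠ 0 := Nat.cast_ne_zero.2 hN.ne'
  have e : tensPow (tau N) 2 = tens (tau N) (tau N) := by
    change tens (tensPow (tau N) 1) (tau N) = _
    rw [tensPow_one]
  -- An opaque bilinear map, so that `τ ⊗ τ` expands by linearity in each argument into the four
  -- known terms.
  obtain ⟨B, hB⟩ : ∃ B : PLin 1 1 →ₗ[ℂ] PLin 1 1 →ₗ[ℂ] PLin 0 2,
      ∀ p q, B p q = comp N (tens p q : PLin 2 2) pairPart :=
    ⟨LinearMap.compr₂ tens ((comp N).flip pairPart), fun _ _ => rfl⟩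
  have h0 : comp N pairPart (tensPow (tau N) 0) = pairPart := comp_id (N := N) pairPart
  have h1 : B idPart idPart = pairPart := (hB _ _).trans idPart_tens_idPart_comp
  have h2 : B idPart disc = doubleSingleton := (hB _ _).trans idPart_tens_disc_comp
  have h3 : B disc idPart = doubleSingleton := (hB _ _).trans disc_tens_idPart_comp
  have h4 : B disc disc = (N : ℂ) • doubleSingleton := (hB _ _).trans disc_tens_disc_comp
  rw [conjTau_apply, h0, e]
  refine (hB _ _).symm.trans ?_
  simp only [tau, map_sub, map_smul, LinearMap.sub_apply, LinearMap.smul_apply, h1, h2, h3, h4]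
  rw [smul_smul (2 / (N : ℂ)) N, div_mul_cancel₀ _ hN']
  module

end PLin

/-! ### The transformed category -/

namespace LinCat

variable {N : ℕ}

/-- The category `𝒯_N K`. -/
noncomputable def conjTau (hN : 0 < N) (K : LinCat N) : LinCat N where
  hom k l := (K.hom k l).map (PLin.conjTau N k l)
  id_mem := ⟨_, K.id_mem, by
    have := PLin.conjTau_id hN 1
    rwa [PLin.tensPow_one] at this⟩
  pair_mem := ⟨_, K.pair_mem, PLin.conjTau_pairPart hN⟩
  tens_mem := by
    rintro k l k' l' _ _ ⟨p, hp, rfl⟩ ⟨q, hq, rfl⟩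
    exact ⟨_, K.tens_mem hp hq, PLin.conjTau_tens p q⟩
  comp_mem := by
    rintro k l m _ _ ⟨q, hq, rfl⟩ ⟨p, hp, rfl⟩
    exact ⟨_, K.comp_mem hq hp, PLin.conjTau_comp hN q p⟩
  adj_mem := by
    rintro k l _ ⟨p, hp, rfl⟩
    exact ⟨_, K.adj_mem hp, PLin.conjTau_adj p⟩

theorem isMonoidalStarIso_conjTau (hN : 0 < N) (K : LinCat N) :
    IsMonoidalStarIso K (K.conjTau hN) (PLin.conjTau N) where
  bijOn k l := by
    refine ⟨fun p hp => ⟨p, hp, rfl⟩, fun p _ q _ h => ?_, fun q hq => hq⟩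
    -- Injectivity comes from the conjugation being an involution.
    rw [← PLin.conjTau_conjTau hN p, h, PLin.conjTau_conjTau hN q]
  map_id := PLin.conjTau_id hN
  map_tens p _ q _ := PLin.conjTau_tens p q
  map_comp q _ p _ := PLin.conjTau_comp hN q p
  map_adj p _ := PLin.conjTau_adj p

theorem isMonoidalStarIso_all (hN : 0 < N) :
    IsMonoidalStarIso (all N) (all N) (PLin.conjTau N) where
  bijOn k l := by
    refine ⟨fun p hp => trivial, fun p _ q _ h => ?_,
      fun q _ => ⟨_, trivial, PLin.conjTau_conjTau hN q⟩⟩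
    rw [← PLin.conjTau_conjTau hN p, h, PLin.conjTau_conjTau hN q]
  map_id := PLin.conjTau_id hN
  map_tens p _ q _ := PLin.conjTau_tens p q
  map_comp q _ p _ := PLin.conjTau_comp hN q p
  map_adj p _ := PLin.conjTau_adj p

end LinCat

/-! ### Scalar matrices over a noncommutative algebra and tensor powers -/

section ScalarMat

variable {ι κ μ : Type*} {A B : Type*} [Ring A] [Ring B]
variable {N : ℕ}

theorem tensorPower_zero (w : Matrix (Fin N) (Fin N) A) : tensorPower w 0 = 1 := by
  ext i j
  rw [Subsingleton.elim i j, Matrix.one_apply_eq]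
  simp [tensorPower]

theorem tensorPower_succ (w : Matrix (Fin N) (Fin N) A) (k : ℕ) (i j : Fin (k + 1) → Fin N) :
    tensorPower w (k + 1) i j = w (i 0) (j 0) * tensorPower w k (Fin.tail i) (Fin.tail j) := by
  simp only [tensorPower, Matrix.of_apply, List.ofFn_succ, List.prod_cons]
  rfl

variable [Algebra ℂ A] [Algebra ℂ B]

theorem scalarMat_mul [Fintype κ] (S : Matrix ι κ ℂ) (T : Matrix κ μ ℂ) :
    scalarMat A (S * T) = scalarMat A S * scalarMat A T :=
  Matrix.map_mul

theorem scalarMat_one [DecidableEq ι] : scalarMat A (1 : Matrix ι ι ℂ) = 1 :=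
  Matrix.map_one _ (map_zero _) (map_one _)

theorem scalarMat_map (f : A →ₐ[ℂ] B) (S : Matrix ι κ ℂ) :
    (scalarMat A S).map f = scalarMat B S := by
  ext i j
  simp [scalarMat]

theorem scalarMat_mul_apply [Fintype κ] (S : Matrix ι κ ℂ) (w : Matrix κ μ A) (i : ι) (j : μ) :
    (scalarMat A S * w) i j = ∑ a, S i a • w a j := by
  simp only [Matrix.mul_apply, scalarMat, Matrix.map_apply, Algebra.smul_def]

theorem mul_scalarMat_apply [Fintype κ] (w : Matrix ι κ A) (S : Matrix κ μ ℂ) (i : ι) (j : μ) :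
    (w * scalarMat A S) i j = ∑ a, S a j • w i a := by
  simp only [Matrix.mul_apply, scalarMat, Matrix.map_apply, Algebra.smul_def, Algebra.commutes]

/-- Transposition does not reverse products over a noncommutative algebra in general; it does here
because scalars are central. -/
theorem transpose_scalarMat_mul [Fintype κ] (S : Matrix ι κ ℂ) (w : Matrix κ μ A) :
    (scalarMat A S * w).transpose = w.transpose * scalarMat A S.transpose := by
  ext i j
  rw [Matrix.transpose_apply, scalarMat_mul_apply, mul_scalarMat_apply]
  rfl

theorem transpose_mul_scalarMat [Fintype κ] (w : Matrix ι κ A) (S : Matrix κ μ ℂ) :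
    (w * scalarMat A S).transpose = scalarMat A S.transpose * w.transpose := by
  ext i j
  rw [Matrix.transpose_apply, scalarMat_mul_apply, mul_scalarMat_apply]
  rfl

theorem isUnit_scalarMat [Fintype ι] [DecidableEq ι] {S : Matrix ι ι ℂ} (hS : IsUnit S) :
    IsUnit (scalarMat A S) :=
  hS.map (algebraMap ℂ A).mapMatrix

theorem tensorPower_map (f : A →ₐ[ℂ] B) (w : Matrix (Fin N) (Fin N) A) (k : ℕ) :
    tensorPower (w.map f) k = (tensorPower w k).map f := by
  ext i j
  simp only [tensorPower, Matrix.of_apply, Matrix.map_apply, map_list_prod, List.map_ofFn]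
  rfl

/-- The tensor power of a scalar matrix. -/
def scalarTensorPower (S : Matrix (Fin N) (Fin N) ℂ) (k : ℕ) :
    Matrix (Fin k → Fin N) (Fin k → Fin N) ℂ :=
  Matrix.of fun i j => ∏ r, S (i r) (j r)

theorem scalarTensorPower_cons (S : Matrix (Fin N) (Fin N) ℂ) (k : ℕ) (i j : Fin (k + 1) → Fin N) :
    scalarTensorPower S (k + 1) i j = S (i 0) (j 0) *
      scalarTensorPower S k (Fin.tail i) (Fin.tail j) := by
  simp only [scalarTensorPower, Matrix.of_apply, Fin.prod_univ_succ]
  rfl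

theorem sum_cons {M : Type*} [AddCommMonoid M] {k : ℕ} (f : (Fin (k + 1) → Fin N) → M) :
    ∑ h, f h = ∑ a, ∑ g : Fin k → Fin N, f (Fin.cons a g) := by
  rw [← (Fin.consEquiv fun _ => Fin N).sum_comp, Fintype.sum_prod_type]
  rfl

/-- Centrality of scalars lets the factors of `S` be collected in front of the product of the
entries of `w`. -/
theorem tensorPower_scalarMat_mul (S : Matrix (Fin N) (Fin N) ℂ) (w : Matrix (Fin N) (Fin N) A)
    (k : ℕ) :
    tensorPower (scalarMat A S * w) k = scalarMat A (scalarTensorPower S k) * tensorPower w k := by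
  induction k with
  | zero =>
    have : scalarTensorPower S 0 = 1 := by
      ext i j
      rw [Subsingleton.elim i j, Matrix.one_apply_eq]
      simp [scalarTensorPower]
    rw [tensorPower_zero, tensorPower_zero, this, scalarMat_one, Matrix.one_mul]
  | succ k ih =>
    ext i j
    rw [tensorPower_succ, ih, scalarMat_mul_apply, scalarMat_mul_apply, scalarMat_mul_apply,
      sum_cons, Finset.sum_mul_sum]
    refine Finset.sum_congr rfl fun a _ => Finset.sum_congr rfl fun g _ => ?_
    rw [tensorPower_succ, scalarTensorPower_cons, smul_mul_smul_comm, Fin.cons_zero, Fin.tail_cons]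

theorem tensorPower_mul_scalarMat (S : Matrix (Fin N) (Fin N) ℂ) (w : Matrix (Fin N) (Fin N) A)
    (k : ℕ) :
    tensorPower (w * scalarMat A S) k = tensorPower w k * scalarMat A (scalarTensorPower S k) := by
  induction k with
  | zero =>
    have : scalarTensorPower S 0 = 1 := by
      ext i j
      rw [Subsingleton.elim i j, Matrix.one_apply_eq]
      simp [scalarTensorPower]
    rw [tensorPower_zero, tensorPower_zero, this, scalarMat_one, Matrix.one_mul]
  | succ k ih =>
    ext i j
    rw [tensorPower_succ, ih, mul_scalarMat_apply, mul_scalarMat_apply, mul_scalarMat_apply,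
      sum_cons, Finset.sum_mul_sum]
    refine Finset.sum_congr rfl fun a _ => Finset.sum_congr rfl fun g _ => ?_
    rw [tensorPower_succ, scalarTensorPower_cons, smul_mul_smul_comm, Fin.cons_zero, Fin.tail_cons]

end ScalarMat

/-! ### Conjugated matrix quantum groups and the subgroup `S_N` -/

namespace MatrixPair

variable {N : ℕ}

theorem tauMat_apply (i j : Fin N) : tauMat N i j = (if i = j then 1 else 0) - 2 / (N : ℂ) := by
  classical
  simp only [tauMat, Matrix.of_apply, PLin.tau, map_sub, map_smul, Matrix.sub_apply,
    Matrix.smul_apply, PLin.T_idPart, PLin.T_disc, smul_eq_mul, mul_one]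

theorem tauMat_mul_tauMat (hN : 0 < N) : tauMat N * tauMat N = 1 := by
  classical
  ext i j
  have h := congrFun (congrFun (congrArg (PLin.T N) (PLin.comp_tau_tau hN)) fun _ => i) fun _ => j
  rw [PLin.T_comp, PLin.T_idPart, Matrix.mul_apply, PLin.sum_fin_one] at h
  rw [Matrix.mul_apply, Matrix.one_apply]
  refine Eq.trans h ?_
  congr

theorem tauMat_inv (hN : 0 < N) : (tauMat N)⁻¹ = tauMat N :=
  Matrix.inv_eq_left_inv (tauMat_mul_tauMat hN)

theorem isUnit_tauMat (hN : 0 < N) : IsUnit (tauMat N) :=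
  .of_mul_eq_one _ (tauMat_mul_tauMat hN)

theorem tauMat_transpose : (tauMat N).transpose = tauMat N := by
  ext i j
  rw [Matrix.transpose_apply, tauMat_apply, tauMat_apply]
  simp only [eq_comm]

theorem tauMat_star (i j : Fin N) : star (tauMat N i j) = tauMat N i j := by
  rw [tauMat_apply]
  split_ifs <;> simp

theorem scalarMat_tau_mul_self {A : Type*} [Ring A] [Algebra ℂ A] (hN : 0 < N) :
    scalarMat A (tauMat N) * scalarMat A (tauMat N) = 1 := by
  rw [← scalarMat_mul, tauMat_mul_tauMat hN, scalarMat_one]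

theorem conj_tau_u (hN : 0 < N) (G : MatrixPair.{u} N) :
    (conj (tauMat N) G).u = scalarMat G.A (tauMat N) * G.u * scalarMat G.A (tauMat N) := by
  change _ * _ * scalarMat G.A (tauMat N)⁻¹ = _
  rw [tauMat_inv hN]

theorem scalarMat_mul_mul_mem {A : Type*} [Ring A] [StarRing A] [Algebra ℂ A] [StarModule ℂ A]
    {m n m' n' : Type*} [Fintype m] [Fintype n]
    (B : StarSubalgebra ℂ A) (S : Matrix m' m ℂ) (S' : Matrix n n' ℂ) (w : Matrix m n A)
    (hw : ∀ i j, w i j ∈ B) (i : m') (j : n') : (scalarMat A S * w * scalarMat A S') i j ∈ B := by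
  rw [mul_scalarMat_apply]
  refine sum_mem fun a _ => SMulMemClass.smul_mem _ ?_
  rw [scalarMat_mul_apply]
  exact sum_mem fun b _ => SMulMemClass.smul_mem _ (hw b a)

theorem adjoin_le_adjoin_of_eq {A : Type*} [Ring A] [StarRing A] [Algebra ℂ A] [StarModule ℂ A]
    {m n m' n' : Type*} [Fintype m] [Fintype n] {S : Matrix m' m ℂ} {S' : Matrix n n' ℂ}
    {w : Matrix m n A} {v : Matrix m' n' A} (h : v = scalarMat A S * w * scalarMat A S') :
    StarAlgebra.adjoin ℂ {a : A | ∃ i j, a = v i j} ≤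
      StarAlgebra.adjoin ℂ {a : A | ∃ i j, a = w i j} := by
  refine StarAlgebra.adjoin_le ?_
  rintro _ ⟨i, j, rfl⟩
  rw [h]
  exact scalarMat_mul_mul_mem (StarAlgebra.adjoin ℂ {a : A | ∃ i j, a = w i j}) S S' w
    (fun i j => StarAlgebra.subset_adjoin ℂ _ ⟨i, j, rfl⟩) i j

theorem map_conj {A B : Type*} [Ring A] [Algebra ℂ A] [Ring B] [Algebra ℂ B] (f : A →ₐ[ℂ] B)
    {m n m' n' : Type*} [Fintype m] [Fintype n] (S : Matrix m' m ℂ) (S' : Matrix n n' ℂ)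
    (w : Matrix m n A) : (scalarMat A S * w * scalarMat A S').map f =
      scalarMat B S * w.map f * scalarMat B S' := by
  rw [Matrix.map_mul, Matrix.map_mul, scalarMat_map, scalarMat_map]

/-- Conjugation preserves compact matrix quantum groups. -/
theorem IsCMQG.conj {G : MatrixPair.{u} N} (hG : G.IsCMQG) {T : Matrix (Fin N) (Fin N) ℂ}
    (hT : IsUnit T) : (conj T G).IsCMQG where
  generates := by
    have hdet : IsUnit T.det := (Matrix.isUnit_iff_isUnit_det T).1 hT
    -- The entries of `u` are linear combinations of those of `T u T⁻¹`, so the latter generate as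
    -- well.
    have e : G.u = scalarMat G.A T⁻¹ * (scalarMat G.A T * G.u * scalarMat G.A T⁻¹) *
        scalarMat G.A T := by
      rw [Matrix.mul_assoc, Matrix.mul_assoc, ← scalarMat_mul, Matrix.nonsing_inv_mul T hdet,
        ← Matrix.mul_assoc, ← Matrix.mul_assoc, ← scalarMat_mul, Matrix.nonsing_inv_mul T hdet,
        scalarMat_one, Matrix.one_mul, Matrix.mul_one]
    have h := StarSubalgebra.topologicalClosure_mono (adjoin_le_adjoin_of_eq e)
    rw [hG.generates] at h
    exact top_le_iff.1 h
  isUnit := ((isUnit_scalarMat hT).mul hG.isUnit).mul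
    (isUnit_scalarMat ((Matrix.isUnit_nonsing_inv_iff).2 hT))
  isUnit_transpose := by
    change IsUnit (_ * G.u * _).transpose
    rw [transpose_mul_scalarMat, transpose_scalarMat_mul]
    exact (isUnit_scalarMat ((Matrix.isUnit_transpose _).2
      ((Matrix.isUnit_nonsing_inv_iff).2 hT))).mul
      (hG.isUnit_transpose.mul (isUnit_scalarMat ((Matrix.isUnit_transpose _).2 hT)))
  comul := by
    obtain ⟨Δ, hΔ⟩ := hG.comul
    have hdet : IsUnit T.det := (Matrix.isUnit_iff_isUnit_det T).1 hT
    let j₁ : G.A →ₐ[ℂ] MinTensor G.A G.A :=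
      (toMinTensor G.A G.A).toAlgHom.comp Algebra.TensorProduct.includeLeft
    let j₂ : G.A →ₐ[ℂ] MinTensor G.A G.A :=
      (toMinTensor G.A G.A).toAlgHom.comp Algebra.TensorProduct.includeRight
    -- Through the two embeddings `a ↦ a ⊗ 1` and `a ↦ 1 ⊗ a`, the comultiplication formula becomes
    -- a product of two matrices; for `T u T⁻¹` the inner `T⁻¹ T` then cancels, so the same `Δ`
    -- serves.
    have key : ∀ w : Matrix (Fin N) (Fin N) G.A,
        (Matrix.of fun i j => toMinTensor G.A G.A (∑ k, w i k ⊗ₜ[ℂ] w k j)) =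
          w.map j₁ * w.map j₂ := fun w => by
      ext i j
      rw [Matrix.of_apply, Matrix.mul_apply, map_sum]
      refine Finset.sum_congr rfl fun k _ => ?_
      change _ = toMinTensor G.A G.A (w i k ⊗ₜ 1) * toMinTensor G.A G.A (1 ⊗ₜ w k j)
      rw [← map_mul, Algebra.TensorProduct.tmul_mul_tmul, mul_one, one_mul]
    have hu : G.u.map Δ.toAlgHom = G.u.map j₁ * G.u.map j₂ := by
      rw [← key]
      ext i j
      exact hΔ i j
    let v : Matrix (Fin N) (Fin N) G.A := scalarMat G.A T * G.u * scalarMat G.A T⁻¹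
    have hv : v.map Δ.toAlgHom = v.map j₁ * v.map j₂ := by
      rw [map_conj, map_conj, map_conj, hu]
      simp only [Matrix.mul_assoc]
      rw [← Matrix.mul_assoc (scalarMat _ T⁻¹) (scalarMat _ T), ← scalarMat_mul,
        Matrix.nonsing_inv_mul T hdet, scalarMat_one, Matrix.one_mul]
    rw [← key] at hv
    exact ⟨Δ, fun i j => congrFun (congrFun hv i) j⟩

/-- An entry of `T_τ` depends only on whether its two indices are equal, which permutations
preserve. -/
theorem symmetricGroup_comm_tau :
    scalarMat _ (tauMat N) * (symmetricGroup N).u =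
      (symmetricGroup N).u * scalarMat (symmetricGroup N).A (tauMat N) := by
  let P : Matrix (Fin N) (Fin N) (Equiv.Perm (Fin N) → ℂ) :=
    Matrix.of fun i j σ => if i = σ j then 1 else 0
  have h : scalarMat _ (tauMat N) * P = P * scalarMat _ (tauMat N) := by
    ext i j σ
    rw [scalarMat_mul_apply, mul_scalarMat_apply, Finset.sum_apply, Finset.sum_apply]
    change ∑ a, tauMat N i a * (if a = σ j then 1 else 0) =
      ∑ a, tauMat N a j * (if i = σ a then 1 else 0)
    have e : ∀ a, (i = σ a) = (a = σ.symm i) := fun a => by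
      rw [Equiv.eq_symm_apply]
      exact propext eq_comm
    simp only [e, mul_boole, Finset.sum_ite_eq', Finset.mem_univ, if_true, tauMat_apply,
      Equiv.symm_apply_eq]
  exact h

theorem symmetricGroup_isSubgroup_conj (hN : 0 < N) {G : MatrixPair.{u} N}
    (h : (symmetricGroup N).IsSubgroup G) :
    (symmetricGroup N).IsSubgroup (conj (tauMat N) G) := by
  obtain ⟨φ, hφ, hu⟩ := h
  refine ⟨φ, hφ, fun i j => ?_⟩
  have hu' : G.u.map φ.toAlgHom = (symmetricGroup N).u := by
    ext i j
    exact hu i j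
  have e : (scalarMat G.A (tauMat N) * G.u * scalarMat G.A (tauMat N)).map φ.toAlgHom =
      (symmetricGroup N).u := by
    rw [map_conj, hu', symmetricGroup_comm_tau, Matrix.mul_assoc, scalarMat_tau_mul_self hN,
      Matrix.mul_one]
  rw [conj_tau_u hN]
  exact congrFun (congrFun e i) j

end MatrixPair

/-! ### Universal property of `C(O_N^+)` and its automorphism given by `τ` -/

namespace FreeStar

variable {X : Type u} {B : Type v} [Ring B] [StarRing B] [Algebra ℂ B]

theorem starAlgHom_ext {f g : FreeStar X →⋆ₐ[ℂ] B} (h : ∀ x, f (gen x) = g (gen x)) : f = g := by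
  ext a
  induction a using induction' with
  | hc c => rw [AlgHomClass.commutes, AlgHomClass.commutes]
  | hg x => exact h x
  | hm a c ha hc => rw [map_mul, map_mul, ha, hc]
  | ha a c ha hc => rw [map_add, map_add, ha, hc]

variable [StarModule ℂ B]

/-- The *-homomorphism on the free *-algebra given by self-adjoint elements. -/
noncomputable def lift (b : X → B) (hb : ∀ x, star (b x) = b x) : FreeStar X →⋆ₐ[ℂ] B where
  __ := (FreeAlgebra.lift ℂ b : FreeAlgebra ℂ X →ₐ[ℂ] B)
  map_star' a := by
    let f : FreeStar X →ₐ[ℂ] B := (FreeAlgebra.lift ℂ b : FreeAlgebra ℂ X →ₐ[ℂ] B)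
    change f (star a) = star (f a)
    induction a using induction' with
    | hc c =>
      rw [← algebraMap_star_comm, AlgHom.commutes, AlgHom.commutes, algebraMap_star_comm]
    | hg x =>
      have hx : f (gen x) = b x := FreeAlgebra.lift_ι_apply b x
      rw [star_gen, hx, hb]
    | hm a c ha hc => rw [star_mul, map_mul, map_mul, star_mul, ha, hc]
    | ha a c ha hc => rw [star_add, map_add, map_add, star_add, ha, hc]

theorem lift_gen (b : X → B) (hb : ∀ x, star (b x) = b x) (x : X) : lift b hb (gen x) = b x :=
  FreeAlgebra.lift_ι_apply b x

end FreeStar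

namespace CStarSeminorm

variable {F : Type u} [Ring F] [StarRing F] [Algebra ℂ F]
variable {B : Type v} [CStarAlgebra B]

/-- The C*-seminorm induced by a *-homomorphism into a C*-algebra. -/
def ofHom (f : F →⋆ₐ[ℂ] B) : CStarSeminorm F where
  toFun a := ‖f a‖
  add_le' a b := by rw [map_add]; exact norm_add_le _ _
  smul' c a := by rw [map_smul, norm_smul]
  mul_le' a b := by rw [map_mul]; exact norm_mul_le _ _
  star_mul_self' a := by rw [map_mul, map_star, CStarRing.norm_star_mul_self, sq]

variable (p : CStarSeminorm F)

open UniformSpace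

/-- A *-homomorphism, seen as a map on the seminormed algebra. -/
def spaceHom (f : F →⋆ₐ[ℂ] B) : p.Space →⋆ₐ[ℂ] B := f

theorem continuous_spaceHom {f : F →⋆ₐ[ℂ] B} (hf : ∀ a, ‖f a‖ ≤ p.toFun a) :
    Continuous (p.spaceHom f) :=
  AddMonoidHomClass.continuous_of_bound (p.spaceHom f) 1 fun a => by
    rw [one_mul]
    exact hf a

/-- The extension of a contractive *-homomorphism to the completion. -/
noncomputable def extend [StarModule ℂ F] (f : F →⋆ₐ[ℂ] B) (hf : ∀ a, ‖f a‖ ≤ p.toFun a) : p.Compl →⋆ₐ[ℂ] B where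
  __ := Completion.extensionHom (p.spaceHom f : p.Space →+* B) (p.continuous_spaceHom hf)
  commutes' c := by
    have : algebraMap ℂ p.Compl c = ((algebraMap ℂ p.Space c : p.Space) : p.Compl) := rfl
    rw [this]
    refine (Completion.extensionHom_coe (p.spaceHom f : p.Space →+* B)
      (p.continuous_spaceHom hf) _).trans ?_
    exact AlgHomClass.commutes f c
  map_star' x := by
    change Completion.extensionHom (p.spaceHom f : p.Space →+* B) (p.continuous_spaceHom hf)
      (star x) = star (Completion.extensionHom (p.spaceHom f : p.Space →+* B)
        (p.continuous_spaceHom hf) x)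
    induction x using Completion.induction_on with
    | hp =>
      have h := Completion.continuous_extension (f := p.spaceHom f)
      exact isClosed_eq (h.comp p.continuous_star_compl) (continuous_star.comp h)
    | ih a =>
      have e : ∀ a, _ := Completion.extensionHom_coe (p.spaceHom f : p.Space →+* B)
        (p.continuous_spaceHom hf)
      rw [← coe_star]
      exact (e (star a)).trans ((map_star f a).trans (congrArg star (e a).symm))

theorem extend_toCompl [StarModule ℂ F] (f : F →⋆ₐ[ℂ] B) (hf : ∀ a, ‖f a‖ ≤ p.toFun a) (a : F) :
    p.extend f hf (p.toCompl a) = f a :=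
  Completion.extensionHom_coe (p.spaceHom f : p.Space →+* B) (p.continuous_spaceHom hf) a

theorem starAlgHom_ext [StarModule ℂ F] {f g : p.Compl →⋆ₐ[ℂ] B} (h : ∀ a, f (p.toCompl a) = g (p.toCompl a)) :
    f = g := by
  have hc : ∀ f : p.Compl →⋆ₐ[ℂ] B, Continuous f := fun f =>
    AddMonoidHomClass.continuous_of_bound f 1 fun a => by
      rw [one_mul]
      exact NonUnitalStarAlgHom.norm_apply_le f a
  ext x
  induction x using Completion.induction_on with
  | hp => exact isClosed_eq (hc f) (hc g)
  | ih a => exact h a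

end CStarSeminorm

namespace MatrixPair

variable {N : ℕ}

/-- The entries of `w` are self-adjoint and `w wᵗ = wᵗ w = 1`. -/
structure IsOrthogonal {A : Type*} [Ring A] [StarRing A] (w : Matrix (Fin N) (Fin N) A) :
    Prop where
  star_eq : ∀ i j, star (w i j) = w i j
  mul_transpose : w * w.transpose = 1
  transpose_mul : w.transpose * w = 1

theorem IsOrthogonal.map {A B : Type*} [Ring A] [StarRing A] [Ring B] [StarRing B] [Algebra ℂ A]
    [Algebra ℂ B] {w : Matrix (Fin N) (Fin N) A} (h : IsOrthogonal w) (f : A →⋆ₐ[ℂ] B) :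
    IsOrthogonal (w.map f.toAlgHom) where
  star_eq i j := by
    change star (f (w i j)) = f (w i j)
    rw [← map_star, h.star_eq]
  mul_transpose := by
    rw [← Matrix.transpose_map, ← Matrix.map_mul, h.mul_transpose,
      Matrix.map_one _ (map_zero _) (map_one _)]
  transpose_mul := by
    rw [← Matrix.transpose_map, ← Matrix.map_mul, h.transpose_mul,
      Matrix.map_one _ (map_zero _) (map_one _)]

/-- Realness of `T_τ` keeps the entries self-adjoint; symmetry and `T_τ² = 1` keep the orthogonality
relations. -/
theorem IsOrthogonal.conj_tau {A : Type*} [Ring A] [StarRing A] [Algebra ℂ A] [StarModule ℂ A]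
    (hN : 0 < N) {w : Matrix (Fin N) (Fin N) A} (h : IsOrthogonal w) :
    IsOrthogonal (scalarMat A (tauMat N) * w * scalarMat A (tauMat N)) where
  star_eq i j := by
    rw [mul_scalarMat_apply]
    simp only [scalarMat_mul_apply, star_sum, star_smul, tauMat_star, h.star_eq]
  mul_transpose := by
    rw [transpose_mul_scalarMat, transpose_scalarMat_mul, tauMat_transpose]
    simp only [Matrix.mul_assoc]
    rw [← Matrix.mul_assoc (scalarMat A (tauMat N)) (scalarMat A (tauMat N)),
      scalarMat_tau_mul_self hN, Matrix.one_mul, ← Matrix.mul_assoc w, h.mul_transpose,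
      Matrix.one_mul, scalarMat_tau_mul_self hN]
  transpose_mul := by
    rw [transpose_mul_scalarMat, transpose_scalarMat_mul, tauMat_transpose]
    simp only [Matrix.mul_assoc]
    rw [← Matrix.mul_assoc (scalarMat A (tauMat N)) (scalarMat A (tauMat N)),
      scalarMat_tau_mul_self hN, Matrix.one_mul, ← Matrix.mul_assoc w.transpose, h.transpose_mul,
      Matrix.one_mul, scalarMat_tau_mul_self hN]

theorem relSeminorm_eq_zero {R : Set (FreeStar (Fin N × Fin N))} {a : FreeStar (Fin N × Fin N)}
    (ha : a ∈ orthRel N ∪ R) : (relSeminorm N R).toFun a = 0 := by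
  change ⨆ p : relSeminorms N R, p.1.toFun a = 0
  simp only [fun p : relSeminorms N R => p.2 a ha]
  exact Real.iSup_const_zero

theorem le_relSeminorm {R : Set (FreeStar (Fin N × Fin N))}
    {p : CStarSeminorm (FreeStar (Fin N × Fin N))} (hp : p ∈ relSeminorms N R)
    (a : FreeStar (Fin N × Fin N)) : p.toFun a ≤ (relSeminorm N R).toFun a := by
  obtain ⟨C, hC⟩ := relSeminorms_bdd N R a
  exact le_ciSup (f := fun p : relSeminorms N R => p.1.toFun a)
    ⟨C, by rintro _ ⟨q, rfl⟩; exact hC _ q.2⟩ ⟨p, hp⟩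

theorem toCompl_eq_zero {R : Set (FreeStar (Fin N × Fin N))} {a : FreeStar (Fin N × Fin N)}
    (ha : a ∈ orthRel N ∪ R) : (relSeminorm N R).toCompl a = 0 := by
  rw [← norm_eq_zero, CStarSeminorm.norm_toCompl, relSeminorm_eq_zero ha]

theorem universal_isOrthogonal (N : ℕ) (R : Set (FreeStar (Fin N × Fin N))) :
    IsOrthogonal (universal N R).u where
  star_eq i j := by
    change star ((relSeminorm N R).toCompl (FreeStar.gen (i, j))) =
      (relSeminorm N R).toCompl (FreeStar.gen (i, j))
    rw [← map_star, FreeStar.star_gen]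
  mul_transpose := by
    have h : (genMat N * (genMat N).transpose).map (relSeminorm N R).toCompl.toAlgHom = 1 := by
      ext i j
      have := toCompl_eq_zero (R := R) (Or.inl ⟨i, j, Or.inl rfl⟩)
      rw [Matrix.sub_apply, map_sub, sub_eq_zero] at this
      refine this.trans ?_
      rw [Matrix.one_apply, Matrix.one_apply]
      split_ifs <;> simp
    rw [Matrix.map_mul] at h
    exact h
  transpose_mul := by
    have h : ((genMat N).transpose * genMat N).map (relSeminorm N R).toCompl.toAlgHom = 1 := by
      ext i j
      have := toCompl_eq_zero (R := R) (Or.inl ⟨i, j, Or.inr rfl⟩)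
      rw [Matrix.sub_apply, map_sub, sub_eq_zero] at this
      refine this.trans ?_
      rw [Matrix.one_apply, Matrix.one_apply]
      split_ifs <;> simp
    rw [Matrix.map_mul] at h
    exact h

/-- The universal property of `C(O_N^+)`. -/
theorem exists_hom_of_isOrthogonal {B : Type v} [CStarAlgebra B] {w : Matrix (Fin N) (Fin N) B}
    (hw : IsOrthogonal w) :
    ∃ ψ : (freeOrthogonal N).A →⋆ₐ[ℂ] B, ∀ i j, ψ ((freeOrthogonal N).u i j) = w i j := by
  let f : FreeStar (Fin N × Fin N) →⋆ₐ[ℂ] B :=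
    FreeStar.lift (fun x => w x.1 x.2) fun x => hw.star_eq _ _
  have hfw : (genMat N).map f.toAlgHom = w := by
    ext i j
    exact FreeStar.lift_gen _ _ _
  -- The seminorm pulled back along `f` satisfies the relations, hence lies below the largest such
  -- seminorm, and `f` extends to the completion.
  have hmem : CStarSeminorm.ofHom f ∈ relSeminorms N ∅ := by
    rintro a (⟨i, j, rfl | rfl⟩ | ha)
    · change ‖f _‖ = 0
      have h : (genMat N * (genMat N).transpose - 1).map f.toAlgHom = 0 := by
        rw [Matrix.map_sub _ (map_sub _), Matrix.map_mul, Matrix.transpose_map, hfw,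
          hw.mul_transpose, Matrix.map_one _ (map_zero _) (map_one _), sub_self]
      rw [norm_eq_zero]
      exact congrFun (congrFun h i) j
    · change ‖f _‖ = 0
      have h : ((genMat N).transpose * genMat N - 1).map f.toAlgHom = 0 := by
        rw [Matrix.map_sub _ (map_sub _), Matrix.map_mul, Matrix.transpose_map, hfw,
          hw.transpose_mul, Matrix.map_one _ (map_zero _) (map_one _), sub_self]
      rw [norm_eq_zero]
      exact congrFun (congrFun h i) j
    · exact ha.elim
  refine ⟨(relSeminorm N ∅).extend f (le_relSeminorm hmem), fun i j => ?_⟩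
  refine ((relSeminorm N ∅).extend_toCompl f (le_relSeminorm hmem) _).trans ?_
  exact congrFun (congrFun hfw i) j

theorem freeOrthogonal_hom_ext {B : Type v} [CStarAlgebra B]
    {f g : (freeOrthogonal N).A →⋆ₐ[ℂ] B}
    (h : ∀ i j, f ((freeOrthogonal N).u i j) = g ((freeOrthogonal N).u i j)) : f = g := by
  refine CStarSeminorm.starAlgHom_ext (relSeminorm N ∅) fun a => ?_
  have : f.comp (relSeminorm N ∅).toCompl = g.comp (relSeminorm N ∅).toCompl :=
    FreeStar.starAlgHom_ext fun x => h x.1 x.2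
  exact DFunLike.congr_fun this a

theorem isOrthogonal_of_isSubgroup {G : MatrixPair.{u} N} {R : Set (FreeStar (Fin N × Fin N))}
    (h : G.IsSubgroup (universal N R)) : IsOrthogonal G.u := by
  obtain ⟨φ, -, hu⟩ := h
  have e : (universal N R).u.map φ.toAlgHom = G.u := by
    ext i j
    exact hu i j
  rw [← e]
  exact (universal_isOrthogonal N R).map φ

/-- Universality gives an endomorphism `ψ` of `C(O_N^+)` with `u ↦ T_τ u T_τ`. It is an involution,
hence surjective, so `φ ∘ ψ` is the required surjection. -/
theorem conj_isSubgroup_freeOrthogonal (hN : 0 < N) {G : MatrixPair.{u} N}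
    (h : G.IsSubgroup (freeOrthogonal N)) : (conj (tauMat N) G).IsSubgroup (freeOrthogonal N) := by
  obtain ⟨φ, hφ, hu⟩ := h
  have hO : IsOrthogonal (freeOrthogonal N).u := universal_isOrthogonal N ∅
  obtain ⟨ψ, hψ⟩ := exists_hom_of_isOrthogonal (hO.conj_tau hN)
  have hψ' : (freeOrthogonal N).u.map ψ.toAlgHom =
      scalarMat _ (tauMat N) * (freeOrthogonal N).u * scalarMat _ (tauMat N) := by
    ext i j
    exact hψ i j
  have hφ' : (freeOrthogonal N).u.map φ.toAlgHom = G.u := by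
    ext i j
    exact hu i j
  have hψψ : ψ.comp ψ = StarAlgHom.id ℂ _ := by
    refine freeOrthogonal_hom_ext fun i j => ?_
    have h : ((freeOrthogonal N).u.map ψ.toAlgHom).map ψ.toAlgHom = (freeOrthogonal N).u := by
      rw [hψ', map_conj, hψ']
      simp only [Matrix.mul_assoc]
      rw [scalarMat_tau_mul_self hN, Matrix.mul_one, ← Matrix.mul_assoc, scalarMat_tau_mul_self hN,
        Matrix.one_mul]
    exact congrFun (congrFun h i) j
  refine ⟨φ.comp ψ, hφ.comp fun a => ⟨ψ a, DFunLike.congr_fun hψψ a⟩, fun i j => ?_⟩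
  have h : ((freeOrthogonal N).u.map ψ.toAlgHom).map φ.toAlgHom =
      scalarMat G.A (tauMat N) * G.u * scalarMat G.A (tauMat N) := by
    rw [hψ', map_conj, hφ']
  rw [conj_tau_u hN]
  exact congrFun (congrFun h i) j

end MatrixPair

/-! ### Intertwiners, the double singleton, and the irreducible parts -/

namespace MatrixPair

variable {N : ℕ}

theorem T_tensPow_tau (k : ℕ) :
    PLin.T N (PLin.tensPow (PLin.tau N) k) = scalarTensorPower (tauMat N) k := by
  ext j i
  exact PLin.T_tensPow _ k j i

theorem scalarTensorPower_tau_mul_self (hN : 0 < N) (k : ℕ) :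
    scalarTensorPower (tauMat N) k * scalarTensorPower (tauMat N) k = 1 := by
  rw [← T_tensPow_tau, ← PLin.T_comp, PLin.comp_tensPow_tau hN, PLin.T_tensPow_idPart]

theorem T_conjTau {k l : ℕ} (p : PLin k l) : PLin.T N (PLin.conjTau N k l p) =
    scalarTensorPower (tauMat N) l * PLin.T N p * scalarTensorPower (tauMat N) k := by
  rw [PLin.conjTau_apply, PLin.T_comp, PLin.T_comp, T_tensPow_tau, T_tensPow_tau, Matrix.mul_assoc]

/-- Multiply by `Q` on the left and by `P` on the right. With tensor powers of `T_τ` for `P` and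
`Q`, this relates intertwiners of the conjugated group to those of the original one. -/
theorem mul_conj_eq_iff {A m n : Type*} [Ring A] [Fintype m] [Fintype n] [DecidableEq m]
    [DecidableEq n] {P U : Matrix m m A} {Q V : Matrix n n A} {X : Matrix n m A}
    (hP : P * P = 1) (hQ : Q * Q = 1) :
    X * (P * U * P) = Q * V * Q * X ↔ Q * X * P * U = V * (Q * X * P) := by
  have hQ' : ∀ Y : Matrix n m A, Q * (Q * Y) = Y := fun Y => by
    rw [← Matrix.mul_assoc, hQ, Matrix.one_mul]
  constructor <;> intro h
  · calc Q * X * P * U = Q * (X * (P * U * P)) * P := by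
          simp only [Matrix.mul_assoc, hP, Matrix.mul_one]
      _ = Q * (Q * V * Q * X) * P := by rw [h]
      _ = V * (Q * X * P) := by simp only [Matrix.mul_assoc, hQ']
  · calc X * (P * U * P) = Q * (Q * X * P * U) * P := by
          simp only [Matrix.mul_assoc, hQ']
      _ = Q * (V * (Q * X * P)) * P := by rw [h]
      _ = Q * V * Q * X := by simp only [Matrix.mul_assoc, hP, Matrix.mul_one]

theorem mem_Mor_conj_tau (hN : 0 < N) {G : MatrixPair.{u} N} {k l : ℕ}
    {X : Matrix (Fin l → Fin N) (Fin k → Fin N) ℂ} :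
    X ∈ (conj (tauMat N) G).Mor k l ↔
      scalarTensorPower (tauMat N) l * X * scalarTensorPower (tauMat N) k ∈ G.Mor k l := by
  have hP : ∀ k, scalarMat G.A (scalarTensorPower (tauMat N) k) *
      scalarMat G.A (scalarTensorPower (tauMat N) k) = 1 := fun k => by
    rw [← scalarMat_mul, scalarTensorPower_tau_mul_self hN, scalarMat_one]
  change scalarMat G.A X * tensorPower (scalarMat G.A (tauMat N) * G.u *
      scalarMat G.A (tauMat N)⁻¹) k = tensorPower (scalarMat G.A (tauMat N) * G.u *
      scalarMat G.A (tauMat N)⁻¹) l * scalarMat G.A X ↔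
    scalarMat G.A _ * tensorPower G.u k = tensorPower G.u l * scalarMat G.A _
  rw [tauMat_inv hN, tensorPower_mul_scalarMat, tensorPower_scalarMat_mul,
    tensorPower_mul_scalarMat, tensorPower_scalarMat_mul, scalarMat_mul, scalarMat_mul]
  exact mul_conj_eq_iff (hP k) (hP l)

theorem Corresponds.conj_tau (hN : 0 < N) {G : MatrixPair.{u} N} {K : LinCat N}
    (h : G.Corresponds K) : (conj (tauMat N) G).Corresponds (K.conjTau hN) := by
  have hS := scalarTensorPower_tau_mul_self hN
  intro k l
  ext X
  rw [mem_Mor_conj_tau hN, h k l]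
  constructor
  · rintro ⟨p, hp, e⟩
    refine ⟨PLin.conjTau N k l p, ⟨p, hp, rfl⟩, ?_⟩
    rw [T_conjTau, e, Matrix.mul_assoc, Matrix.mul_assoc, hS, Matrix.mul_one, ← Matrix.mul_assoc,
      hS, Matrix.one_mul]
  · rintro ⟨_, ⟨p, hp, rfl⟩, rfl⟩
    refine ⟨p, hp, ?_⟩
    rw [T_conjTau, Matrix.mul_assoc, Matrix.mul_assoc, hS, Matrix.mul_one, ← Matrix.mul_assoc,
      hS, Matrix.one_mul]

/-- If the double singleton is an intertwiner, then all products of two row sums are `1`. -/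
theorem rowSum_mul_rowSum {G : MatrixPair.{u} N}
    (h : PLin.T N PLin.doubleSingleton ∈ G.Mor 0 2) (i j : Fin N) :
    (∑ a, G.u i a) * ∑ a, G.u j a = 1 := by
  have h' : scalarMat G.A (PLin.T N PLin.doubleSingleton) * tensorPower G.u 0 =
    tensorPower G.u 2 * scalarMat G.A (PLin.T N PLin.doubleSingleton) := h
  -- The entry of the intertwiner equation at `(i, j)` reads `1 = ∑_{a,b} u_{ia} u_{jb}`.
  have e := congrFun (congrFun h' ![i, j]) Fin.elim0
  rw [tensorPower_zero, Matrix.mul_one, mul_scalarMat_apply] at e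
  simp only [PLin.T_doubleSingleton, one_smul, scalarMat, Matrix.map_apply, map_one] at e
  rw [e, Finset.sum_mul_sum, sum_cons]
  refine Finset.sum_congr rfl fun a _ => ?_
  rw [PLin.sum_fin_one]
  refine Finset.sum_congr rfl fun b _ => ?_
  simp [tensorPower, List.ofFn_succ]

/-- `J u` has the column sums of `u` as entries and `u J` the row sums, so it suffices that all of
these are one and the same element. -/
theorem scalarMat_tau_comm {G : MatrixPair.{u} N} (hG : IsOrthogonal G.u)
    (h : PLin.T N PLin.doubleSingleton ∈ G.Mor 0 2) :
    scalarMat G.A (tauMat N) * G.u = G.u * scalarMat G.A (tauMat N) := by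
  have hr := rowSum_mul_rowSum h
  -- With row sums `r_i`, both `r_i r_j = 1` and `r_i r_i = 1` hold, so `r_i = r_i (r_i r_j) = r_j`.
  have hrow : ∀ i j, ∑ a, G.u i a = ∑ a, G.u j a := fun i j => by
    calc ∑ a, G.u i a = (∑ a, G.u i a) * ((∑ a, G.u i a) * ∑ a, G.u j a) := by rw [hr, mul_one]
      _ = ∑ a, G.u j a := by rw [← mul_assoc, hr, one_mul]
  have hcol : ∀ i j, ∑ a, G.u a j = ∑ b, G.u i b := fun i j => by
    -- As row sums agree, the one of row `i` may be replaced, next to each `u_{aj}`, by that of row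
    -- `a`; this produces the sum of row `j` of `uᵗ u = 1`.
    have h1 : (∑ a, G.u a j) * ∑ b, G.u i b = 1 := by
      calc (∑ a, G.u a j) * ∑ b, G.u i b = ∑ b, ∑ a, G.u a j * G.u a b := by
            rw [Finset.sum_mul, Finset.sum_comm]
            refine Finset.sum_congr rfl fun a _ => ?_
            rw [hrow i a, Finset.mul_sum]
        _ = ∑ b, (G.u.transpose * G.u) j b := rfl
        _ = 1 := by simp [hG.transpose_mul, Matrix.one_apply]
    calc ∑ a, G.u a j = (∑ a, G.u a j) * ((∑ b, G.u i b) * ∑ b, G.u i b) := by rw [hr, mul_one]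
      _ = ∑ b, G.u i b := by rw [← mul_assoc, h1, one_mul]
  ext i j
  rw [scalarMat_mul_apply, mul_scalarMat_apply]
  simp only [tauMat_apply, sub_smul, Finset.sum_sub_distrib, ← Finset.smul_sum, hcol i j, ite_smul,
    one_smul, zero_smul, Finset.sum_ite_eq, Finset.sum_ite_eq', Finset.mem_univ, if_true]

theorem identical_conj_tau (hN : 0 < N) {G : MatrixPair.{u} N} (hG : IsOrthogonal G.u)
    (h : PLin.T N PLin.doubleSingleton ∈ G.Mor 0 2) : Identical (conj (tauMat N) G) G := by
  have e : (conj (tauMat N) G).u = G.u := by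
    rw [conj_tau_u hN, scalarMat_tau_comm hG h, Matrix.mul_assoc, scalarMat_tau_mul_self hN,
      Matrix.mul_one]
  exact ⟨StarAlgEquiv.refl (R := ℂ) (A := G.A), fun i j => congrFun (congrFun e i) j⟩

/-- Intertwiner equations are preserved by the homomorphism onto `C(H)`; thus the double singleton
passes from `B_N^{#+}` to all its quantum subgroups. -/
theorem Mor_subset_of_isSubgroup {H : MatrixPair.{u} N} {G : MatrixPair.{v} N}
    (h : H.IsSubgroup G) (k l : ℕ) : G.Mor k l ⊆ H.Mor k l := by
  obtain ⟨φ, -, hu⟩ := h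
  have e : G.u.map φ.toAlgHom = H.u := by
    ext i j
    exact hu i j
  intro X hX
  have := congrArg (fun M => M.map φ.toAlgHom) (show scalarMat G.A X * tensorPower G.u k =
    tensorPower G.u l * scalarMat G.A X from hX)
  simp only [Matrix.map_mul, scalarMat_map, ← tensorPower_map, e] at this
  exact this

theorem T_mem_Mor_ofCategory {K : LinCat N} {k l : ℕ} {p : PLin k l} (hp : p ∈ K.hom k l) :
    PLin.T N p ∈ (ofCategory K).Mor k l := by
  set R := {a | ∃ (k l : ℕ), ∃ p ∈ K.hom k l, ∃ (j : Fin l → Fin N) (i : Fin k → Fin N),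
    a = (scalarMat (FreeStar (Fin N × Fin N)) (PLin.T N p) * tensorPower (genMat N) k -
      tensorPower (genMat N) l * scalarMat (FreeStar (Fin N × Fin N)) (PLin.T N p)) j i}
  have h : (scalarMat (FreeStar (Fin N × Fin N)) (PLin.T N p) * tensorPower (genMat N) k).map
      (relSeminorm N R).toCompl.toAlgHom = (tensorPower (genMat N) l *
        scalarMat (FreeStar (Fin N × Fin N)) (PLin.T N p)).map
          (relSeminorm N R).toCompl.toAlgHom := by
    ext j i
    have := toCompl_eq_zero (R := R) (Or.inr ⟨k, l, p, hp, j, i, rfl⟩)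
    rw [Matrix.sub_apply, map_sub, sub_eq_zero] at this
    exact this
  rw [Matrix.map_mul, Matrix.map_mul, scalarMat_map, ← tensorPower_map, ← tensorPower_map] at h
  exact h

theorem doubleSingleton_mem_generate :
    PLin.doubleSingleton ∈ (LinCat.generate N PLin.doubleSingleton).hom 0 2 :=
  (Submodule.mem_iInf _).2 fun K => K.2

theorem identical_conj_tau_of_isSubgroup (hN : 0 < N) {G : MatrixPair.{u} N}
    (h : G.IsSubgroup (freeBistochasticSharp N)) : Identical (conj (tauMat N) G) G :=
  identical_conj_tau hN (isOrthogonal_of_isSubgroup h)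
    (Mor_subset_of_isSubgroup h 0 2 (T_mem_Mor_ofCategory doubleSingleton_mem_generate))

/-- Here `T_τ` has size `n = N - 1` and negates constant vectors, such as the last column. Any other
column `e_j - (1/n)(1 + ε s) 1`, with `1` the all-ones vector, goes to `e_j - (2/n) 1 + (1/n)(1 + ε
s) 1 = e_j - (1/n)(1 - ε s) 1`. The value of `s = 1/√N` plays no role. -/
theorem tauMat_mul_irrV {n : ℕ} (hn : 0 < n) (ε : ℤˣ) :
    tauMat n * irrV n ε = irrV n (-ε) := by
  have hn' : (n : ℂ) ≠ 0 := Nat.cast_ne_zero.2 hn.ne'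
  ext i j
  rw [Matrix.mul_apply]
  simp only [tauMat_apply, irrV, irrU, Matrix.of_apply, sub_mul, Finset.sum_sub_distrib, ite_mul,
    one_mul, zero_mul, Finset.sum_ite_eq, Finset.mem_univ, if_true, ← Finset.mul_sum]
  set s : ℂ := 1 / (√((n : ℝ) + 1) : ℝ)
  have hne : ∀ i : Fin n, i.castSucc ≠ Fin.last n := fun i => (Fin.castSucc_lt_last i).ne
  refine Fin.lastCases ?_ (fun j => ?_) j
  · simp only [or_true, if_true, Finset.sum_const, Finset.card_univ, Fintype.card_fin, nsmul_eq_mul,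
      Units.val_neg, Int.cast_neg]
    field_simp
    ring
  · simp only [hne, or_self, if_false, Finset.sum_sub_distrib, Fin.castSucc_inj,
      Finset.sum_ite_eq', Finset.mem_univ, if_true, Finset.sum_const, Finset.card_univ,
      Fintype.card_fin, nsmul_eq_mul, Units.val_neg, Int.cast_neg]
    field_simp
    ring

theorem compressMat_mul {n : ℕ} (hn : 0 < n) {V : Matrix (Fin n) (Fin N) ℂ}
    (G : MatrixPair.{u} N) : compressMat (tauMat n * V) G =
      scalarMat G.A (tauMat n) * compressMat V G * scalarMat G.A (tauMat n)⁻¹ := by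
  have hs : (tauMat n).conjTranspose = tauMat n := by
    rw [Matrix.conjTranspose, tauMat_transpose]
    ext i j
    exact tauMat_star i j
  rw [compressMat, compressMat, Matrix.conjTranspose_mul, hs, tauMat_inv hn, scalarMat_mul,
    scalarMat_mul]
  simp only [Matrix.mul_assoc]

/-- The entries of either compressed matrix are linear combinations of those of the other, because
`T_τ` is an involution. -/
theorem compressAlg_mul {n : ℕ} (hn : 0 < n) (V : Matrix (Fin n) (Fin N) ℂ)
    (G : MatrixPair.{u} N) : compressAlg (tauMat n * V) G = compressAlg V G := by
  refine le_antisymm (StarSubalgebra.topologicalClosure_mono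
    (adjoin_le_adjoin_of_eq (compressMat_mul hn G))) (StarSubalgebra.topologicalClosure_mono
    (adjoin_le_adjoin_of_eq (S := tauMat n) (S' := (tauMat n)⁻¹) ?_))
  rw [← compressMat_mul hn, ← Matrix.mul_assoc, tauMat_mul_tauMat hn, Matrix.one_mul]

/-- A closed *-subalgebra of a C*-algebra with a matrix over it. -/
noncomputable abbrev ofStarSubalgebra {A : Type u} [CStarAlgebra A] (S : StarSubalgebra ℂ A)
    (hS : IsClosed (S : Set A)) (w : Matrix (Fin N) (Fin N) A) (hw : ∀ i j, w i j ∈ S) :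
    MatrixPair.{u} N where
  A := S
  cstar := StarSubalgebra.cstarAlgebra S (h_closed := hS)
  u := Matrix.of fun i j => ⟨w i j, hw i j⟩

/-- Stating this for arbitrary closed subalgebras with `S = S'` as a hypothesis allows substitution,
after which both matrices live over one type and can be compared inside `A`. -/
theorem identical_conj_ofStarSubalgebra {A : Type u} [CStarAlgebra A] {S S' : StarSubalgebra ℂ A}
    (hS : IsClosed (S : Set A)) (hS' : IsClosed (S' : Set A)) {w w' : Matrix (Fin N) (Fin N) A}
    (hw : ∀ i j, w i j ∈ S) (hw' : ∀ i j, w' i j ∈ S') (T : Matrix (Fin N) (Fin N) ℂ)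
    (hSS' : S = S') (hww' : w' = scalarMat A T * w * scalarMat A T⁻¹) :
    Identical (conj T (ofStarSubalgebra S hS w hw)) (ofStarSubalgebra S' hS' w' hw') := by
  subst hSS'
  have h : (scalarMat S T * (Matrix.of fun i j => (⟨w i j, hw i j⟩ : S)) * scalarMat S T⁻¹).map
      S.subtype.toAlgHom = w' := by
    rw [map_conj, hww']
    rfl
  have h' : scalarMat S T * (Matrix.of fun i j => (⟨w i j, hw i j⟩ : S)) * scalarMat S T⁻¹ =
      Matrix.of fun i j => (⟨w' i j, hw' i j⟩ : S) := by
    ext i j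
    exact congrFun (congrFun h i) j
  refine ⟨StarAlgEquiv.refl (R := ℂ) (A := S), fun i j => ?_⟩
  exact congrFun (congrFun h' i) j

theorem identical_conj_compress {n : ℕ} (hn : 0 < n) (V : Matrix (Fin n) (Fin N) ℂ)
    (G : MatrixPair.{u} N) :
    Identical (conj (tauMat n) (compress V G)) (compress (tauMat n * V) G) :=
  identical_conj_ofStarSubalgebra (StarSubalgebra.isClosed_topologicalClosure _)
    (StarSubalgebra.isClosed_topologicalClosure _) _ _ (tauMat n) (compressAlg_mul hn V G).symm
    (compressMat_mul hn G)

end MatrixPair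

theorem theoremB :
    (∀ N : ℕ, 0 < N → ∀ G : MatrixPair.{u} N, G.IsCMQG →
      (MatrixPair.symmetricGroup N).IsSubgroup G → G.IsSubgroup (MatrixPair.freeOrthogonal N) →
      ∀ K : LinCat N, G.Corresponds K →
        IsUnit (MatrixPair.tauMat N) ∧
        (MatrixPair.conj (MatrixPair.tauMat N) G).IsCMQG ∧
        (MatrixPair.symmetricGroup N).IsSubgroup (MatrixPair.conj (MatrixPair.tauMat N) G) ∧
        (MatrixPair.conj (MatrixPair.tauMat N) G).IsSubgroup (MatrixPair.freeOrthogonal N) ∧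
        (∃ L : LinCat N,
          (∀ k l, (L.hom k l : Set (PLin k l)) =
            {q | ∃ p ∈ K.hom k l, q = PLin.conjTau N k l p}) ∧
          (MatrixPair.conj (MatrixPair.tauMat N) G).Corresponds L ∧
          LinCat.IsMonoidalStarIso K L (PLin.conjTau N)) ∧
        LinCat.IsMonoidalStarIso (LinCat.all N) (LinCat.all N) (PLin.conjTau N) ∧
        (PLin.doubleSingleton ∈ K.hom 0 2 →
          MatrixPair.Identical (MatrixPair.conj (MatrixPair.tauMat N) G) G)) ∧
    (∀ N : ℕ, 0 < N → ∀ G : MatrixPair.{u} N, G.IsCMQG →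
      (MatrixPair.symmetricGroup N).IsSubgroup G →
      G.IsSubgroup (MatrixPair.freeBistochasticSharp N) →
        MatrixPair.Identical (MatrixPair.conj (MatrixPair.tauMat N) G) G) ∧
    (∀ n : ℕ, 0 < n → ∀ G : MatrixPair.{u} (n + 1), G.IsCMQG →
      (MatrixPair.symmetricGroup (n + 1)).IsSubgroup G →
      G.IsSubgroup (MatrixPair.freeBistochasticSharp (n + 1)) →
        IsUnit (MatrixPair.tauMat n) ∧
        ∀ ε : ℤˣ, MatrixPair.Identical
          (MatrixPair.conj (MatrixPair.tauMat n) (MatrixPair.irr ε G)) (MatrixPair.irr (-ε) G)) := by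
  refine ⟨fun N hN G hG hS hO K hK => ?_, fun N hN G _ _ hB => ?_, fun n hn G _ _ _ => ?_⟩
  · refine ⟨MatrixPair.isUnit_tauMat hN, hG.conj (MatrixPair.isUnit_tauMat hN),
      MatrixPair.symmetricGroup_isSubgroup_conj hN hS,
      MatrixPair.conj_isSubgroup_freeOrthogonal hN hO,
      ⟨K.conjTau hN, fun k l => ?_, hK.conj_tau hN, LinCat.isMonoidalStarIso_conjTau hN K⟩,
      LinCat.isMonoidalStarIso_all hN, fun hds => ?_⟩
    · ext q
      exact exists_congr fun p => and_congr_right fun _ => eq_comm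
    · refine MatrixPair.identical_conj_tau hN (MatrixPair.isOrthogonal_of_isSubgroup hO) ?_
      rw [hK]
      exact ⟨_, hds, rfl⟩
  · exact MatrixPair.identical_conj_tau_of_isSubgroup hN hB
  · refine ⟨MatrixPair.isUnit_tauMat hn, fun ε => ?_⟩
    have h := MatrixPair.identical_conj_compress hn (MatrixPair.irrV n ε) G
    rwa [MatrixPair.tauMat_mul_irrV hn] at h
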